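/- Let $F$ be a non-archimedean local field with ring of integers $\mathcal O$, maximal ideal $\mathfrak p$ and (finite) residue field $k$ of characteristic $p$. Let $l\ge 2$, $r=2l-1$, $l'=l-1$. Write $\mathcal O_n=\mathcal O/\mathfrak p^n$, $G_r=\mathrm{GL}_2(\mathcal O_r)$ and $K_i=\{g\in G_r: g\equiv 1 \bmod \mathfrak p^i\}$. Let $\psi:\mathcal O\to\mathbb C^\times$ be an additive character with conductor $\mathfrak p^r$ (for $n\ge 0$, $\psi$ is trivial on $\mathfrak p^n$ if and only if $n\ge r$). Let $\beta\in M_2(\mathcal O_{l'})$ be cuspidal, i.e. its characteristic polynomial is irreducible modulo $\mathfrak p$ (for instance $\beta=\begin{pmatrix}0&1\\-\Delta&s\end{pmatrix}$ with $x^2-sx+\Delta$ irreducible mod $\mathfrak p$), and let $\hat\beta\in M_2(\mathcal O_r)$ be any lift of $\beta$. Let $\psi_\beta$ be the character $x\mapsto\psi(\mathrm{Tr}(\beta(x-1)))$ of $K_l$, let $T=T(\psi_\beta)$ be its stabilizer in $G_r$, and put $Z^1=\mathcal O_r[\hat\beta]^\times\cap K_1$. Representations are complex; a representation of a group is said to contain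 a representation of a subgroup if its restriction does. Then: 1. $\psi_\beta$ extends to a linear character of $Z^1K_l$. The group $Z^1K_l$ is normal in $T$, and $Z^1K_{l'}/Z^1K_l$ is an elementary abelian $p$-group. 2. Let $\tilde\psi_\beta$ be any extension of $\psi_\beta$ to a linear character of $Z^1K_l$. It is stabilized by $T$; the commutator form $(xZ^1K_l,yZ^1K_l)\mapsto\tilde\psi_\beta(xyx^{-1}y^{-1})$ on $Z^1K_{l'}/Z^1K_l$ is a well-defined, non-degenerate, alternating bilinear form with values in $\mathbb C^\times$; and there is, up to isomorphism, exactly one irreducible representation $\eta_\beta$ of $Z^1K_{l'}$ containing $\tilde\psi_\beta$. 3. $Z^1K_{l'}$ is a normal subgroup of $T$ and $T/Z^1K_{l'}$ is cyclic. Each $\eta_\beta$ as in 2 is stabilized by $T$ and extends to a representation $\tilde\eta_\beta$ of $T$. 4. Let $\tilde\eta_\beta$ run over all representations of $T$ that extend some $\eta_\beta$ as in 2, for some extension $\tilde\psi_\beta$ of $\psi_\beta$. Every irreducible component of $\mathrm{Ind}_{K_l}^{T}(\psi_\beta)$ is such an $\tilde\eta_\beta$. Each $\mathrm{Ind}_T^{G_r}(\tilde\eta_\beta)$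 is irreducible and contains $\psi_\beta$; every irreducible representation of $G_r$ containing $\psi_\beta$ is isomorphic to $\mathrm{Ind}_T^{G_r}(\tilde\eta_\beta)$ for some $\tilde\eta_\beta$; and non-isomorphic $\tilde\eta_\beta$ give non-isomorphic induced representations. -/

import Mathlib

open IsLocalRing ValuativeRel
open scoped Matrix commutatorElement

noncomputable section

namespace CuspidalGL2

/-! ### Representations of a subgroup of a group -/

section Group

variable {G : Type*} [Group G]

/-- `π` contains `ρ`: there is an injective intertwining map from `ρ` to `π`. -/
def Contains {V W : Type*} [AddCommGroup V] [Module ℂ V] [AddCommGroup W] [Module ℂ W]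
    (π : Representation ℂ G V) (ρ : Representation ℂ G W) : Prop :=
  ∃ f : Representation.IntertwiningMap ρ π, Function.Injective f

/-- The one-dimensional representation on `ℂ` attached to a linear character
(a homomorphism from a group to the monoid `ℂ` automatically has values in `ℂˣ`). -/
def oneDim (χ : G →* ℂ) : Representation ℂ G ℂ where
  toFun g := χ g • LinearMap.id
  map_one' := by simp [Module.End.one_eq_id]
  map_mul' x y := by
    ext
    simp [mul_comm]

/-- The stabilizer in `G` of a representation `ρ` of a subgroup `H`: the elements `g` that
normalize `H` and for which the conjugate representation `x ↦ ρ (g x g⁻¹)` of `H` is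
isomorphic to `ρ`. -/
def stabilizer {H : Subgroup G} {V : Type*} [AddCommGroup V] [Module ℂ V]
    (ρ : Representation ℂ H V) : Subgroup G where
  carrier := {g | (∀ x, x ∈ H ↔ g * x * g⁻¹ ∈ H) ∧
    ∃ e : V ≃ₗ[ℂ] V, ∀ x y : H, (y : G) = g * x * g⁻¹ → ∀ v, e (ρ x v) = ρ y (e v)}
  one_mem' := by
    refine ⟨by simp, LinearEquiv.refl ℂ V, fun x y h v => ?_⟩
    obtain rfl : y = x := Subtype.ext (by simpa using h)
    rfl
  mul_mem' := by
    rintro a b ⟨ha, e, he⟩ ⟨hb, f, hf⟩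
    refine ⟨fun x => ?_, f.trans e, fun x y h v => ?_⟩
    · rw [hb, ha]
      simp [mul_assoc]
    · have h1 := hf x ⟨b * x * b⁻¹, (hb x).1 x.2⟩ rfl v
      have h2 := he ⟨b * x * b⁻¹, (hb x).1 x.2⟩ y (by simpa [mul_assoc] using h) (f v)
      simp only [LinearEquiv.trans_apply, h1, h2]
  inv_mem' := by
    rintro a ⟨ha, e, he⟩
    refine ⟨fun x => ?_, e.symm, fun x y h v => ?_⟩
    · rw [ha (a⁻¹ * x * a⁻¹⁻¹)]
      simp [mul_assoc]
    · have h1 := he y x (by rw [h]; simp [mul_assoc]) (e.symm v)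
      rw [LinearEquiv.apply_symm_apply] at h1
      rw [← h1, LinearEquiv.symm_apply_apply]

/-- For subgroups `N ≤ H`: `N` is normal in `H` and `H / N` is an elementary abelian
`p`-group. -/
def IsElementaryAbelianQuotient (p : ℕ) (N H : Subgroup G) : Prop :=
  (N.subgroupOf H).Normal ∧ (∀ x ∈ H, ∀ y ∈ H, ⁅x, y⁆ ∈ N) ∧ ∀ x ∈ H, x ^ p ∈ N

/-- For subgroups `N ≤ H` and a linear character `χ` of `N`: the rule
`(x N, y N) ↦ χ (x y x⁻¹ y⁻¹)` is a well-defined, bilinear, alternating and non-degenerate form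
`H / N × H / N → ℂˣ`. -/
def HasNondegenerateCommutatorForm (N H : Subgroup G) (χ : N →* ℂ) : Prop :=
  ∃ (_ : (N.subgroupOf H).Normal) (h : H ⧸ N.subgroupOf H → H ⧸ N.subgroupOf H → ℂ),
    (∀ x y : H, ∃ hxy : ⁅(x : G), (y : G)⁆ ∈ N,
      h (QuotientGroup.mk x) (QuotientGroup.mk y) = χ ⟨⁅(x : G), (y : G)⁆, hxy⟩) ∧
    (∀ a b c, h (a * b) c = h a c * h b c) ∧
    (∀ a b c, h a (b * c) = h a b * h a c) ∧
    (∀ a, h a a = 1) ∧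
    (∀ a, (∀ b, h a b = 1) → a = 1)

end Group

/-! ### The groups `GL₂(O / 𝔭 ^ r)` -/

theorem trace_mul_mem {O : Type*} [CommRing O] {I J : Ideal O} {A B : Matrix (Fin 2) (Fin 2) O}
    (hA : ∀ i j, A i j ∈ I) (hB : ∀ i j, B i j ∈ J) : Matrix.trace (A * B) ∈ I * J := by
  rw [Matrix.trace]
  refine Ideal.sum_mem _ fun i _ => ?_
  rw [Matrix.diag_apply, Matrix.mul_apply]
  exact Ideal.sum_mem _ fun j _ => Ideal.mul_mem_mul (hA _ _) (hB _ _)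

section Ring

variable {O : Type*} [CommRing O] [IsLocalRing O]

/-- The ring `O / 𝔭 ^ n`. -/
abbrev OMod (O : Type*) [CommRing O] [IsLocalRing O] (n : ℕ) : Type _ := O ⧸ maximalIdeal O ^ n

/-- The projection `O → O / 𝔭 ^ n`. -/
abbrev toOMod (O : Type*) [CommRing O] [IsLocalRing O] (n : ℕ) : O →+* OMod O n :=
  Ideal.Quotient.mk (maximalIdeal O ^ n)

/-- The projection `O / 𝔭 ^ n → O / 𝔭 ^ m` for `m ≤ n`. -/
def red {m n : ℕ} (h : m ≤ n) : OMod O n →+* OMod O m :=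
  Ideal.Quotient.factor (Ideal.pow_le_pow_right h)

/-- The projection from `O / 𝔭 ^ n` to the residue field `O / 𝔭`, for `n ≠ 0`. -/
def toResidue {n : ℕ} (h : n ≠ 0) : OMod O n →+* ResidueField O :=
  Ideal.Quotient.factor (Ideal.pow_le_self h)

/-- The group `G_r = GL₂(O / 𝔭 ^ r)`. -/
abbrev Gr (O : Type*) [CommRing O] [IsLocalRing O] (r : ℕ) : Type _ := GL (Fin 2) (OMod O r)

/-- The congruence subgroup `K_i` of `G_r`: all `g` with `g ≡ 1` modulo `𝔭 ^ i`. -/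
def K (O : Type*) [CommRing O] [IsLocalRing O] (r i : ℕ) : Subgroup (Gr O r) :=
  (Matrix.GeneralLinearGroup.map
    (Ideal.Quotient.mk ((maximalIdeal O ^ i).map (toOMod O r)))).ker

/-- The additive character `ψ` of `O` has conductor `𝔭 ^ r`: among the powers of `𝔭`, it is
trivial exactly on those contained in `𝔭 ^ r`. -/
def HasConductor (ψ : AddChar O ℂ) (r : ℕ) : Prop :=
  ∀ n : ℕ, (∀ x ∈ maximalIdeal O ^ n, ψ x = 1) ↔ r ≤ n

/-- The value `ψ (Tr (β (x - 1)))`, computed with lifts of `β` and `x` to `O`. -/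
def psiVal {r l' : ℕ} (ψ : AddChar O ℂ) (β : Matrix (Fin 2) (Fin 2) (OMod O l'))
    (x : Matrix (Fin 2) (Fin 2) (OMod O r)) : ℂ :=
  ψ (Matrix.trace (β.map Quotient.out * (x.map Quotient.out - 1)))

theorem mem_K {r i : ℕ} (hi : i ≤ r) {x : Gr O r} (hx : x ∈ K O r i)
    {X : Matrix (Fin 2) (Fin 2) O} (hX : X.map (toOMod O r) = x) (a b : Fin 2) :
    (X - 1) a b ∈ maximalIdeal O ^ i := by
  have h0 : Matrix.GeneralLinearGroup.map
      (Ideal.Quotient.mk ((maximalIdeal O ^ i).map (toOMod O r))) x = 1 := hx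
  have h1 := congrArg (fun g : GL (Fin 2) _ => g.val a b) h0
  have h2 : toOMod O r ((X - 1) a b) ∈ (maximalIdeal O ^ i).map (toOMod O r) := by
    rw [← Ideal.Quotient.eq_zero_iff_mem]
    have h3 : toOMod O r (X a b) = (x : Matrix (Fin 2) (Fin 2) _) a b := by rw [← hX]; rfl
    simp only [Matrix.GeneralLinearGroup.map_apply, Units.val_one] at h1
    rw [Matrix.sub_apply, map_sub, map_sub, h3, h1]
    by_cases hab : a = b <;> simp [hab, Matrix.one_apply]
  rw [Ideal.mem_map_iff_of_surjective _ Ideal.Quotient.mk_surjective] at h2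
  obtain ⟨y, hy, hyx⟩ := h2
  rw [Ideal.Quotient.mk_eq_mk_iff_sub_mem] at hyx
  have := sub_mem hy (Ideal.pow_le_pow_right hi hyx)
  rwa [sub_sub_cancel] at this

/-- `psiVal` does not depend on the lifts. -/
theorem psiVal_eq {r l l' : ℕ} (hr : l + l' = r) {ψ : AddChar O ℂ} (hψ : HasConductor ψ r)
    (β : Matrix (Fin 2) (Fin 2) (OMod O l')) {x : Gr O r} (hx : x ∈ K O r l)
    {B X : Matrix (Fin 2) (Fin 2) O} (hB : B.map (toOMod O l') = β) (hX : X.map (toOMod O r) = x) :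
    psiVal ψ β x.val = ψ (Matrix.trace (B * (X - 1))) := by
  set B' : Matrix (Fin 2) (Fin 2) O := β.map Quotient.out with hB'
  set X' : Matrix (Fin 2) (Fin 2) O := x.val.map Quotient.out with hX'
  have hB'' : B'.map (toOMod O l') = β := by
    ext i j
    exact Ideal.Quotient.mk_out _
  have hX'' : X'.map (toOMod O r) = x := by
    ext i j
    exact Ideal.Quotient.mk_out _
  have e : Matrix.trace (B' * (X' - 1)) =
      Matrix.trace (B * (X - 1)) +
        (Matrix.trace ((B' - B) * (X' - 1)) + Matrix.trace (B * (X' - X))) := by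
    rw [← Matrix.trace_add, ← Matrix.trace_add]
    congr 1
    noncomm_ring
  have m1 : Matrix.trace ((B' - B) * (X' - 1)) ∈ maximalIdeal O ^ r := by
    rw [← hr, add_comm l l', pow_add]
    refine trace_mul_mem (fun i j => ?_) (fun i j => mem_K (by omega) hx hX'' i j)
    rw [Matrix.sub_apply, ← Ideal.Quotient.mk_eq_mk_iff_sub_mem]
    exact congrFun (congrFun (hB''.trans hB.symm) i) j
  have m2 : Matrix.trace (B * (X' - X)) ∈ maximalIdeal O ^ r := by
    rw [← one_mul (maximalIdeal O ^ r), Ideal.one_eq_top]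
    refine trace_mul_mem (fun i j => trivial) (fun i j => ?_)
    rw [Matrix.sub_apply, ← Ideal.Quotient.mk_eq_mk_iff_sub_mem]
    exact congrFun (congrFun (hX''.trans hX.symm) i) j
  rw [psiVal, e, AddChar.map_add_eq_mul, (hψ r).2 le_rfl _ (add_mem m1 m2), mul_one]

/-- The linear character `ψ_β : x ↦ ψ (Tr (β (x - 1)))` of `K_l`, for `β ∈ M₂(O / 𝔭 ^ l')`,
where `l + l' = r` and `l' ≤ l`. -/
def psiBeta {r l l' : ℕ} (hr : l + l' = r) (hl : l' ≤ l) {ψ : AddChar O ℂ}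
    (hψ : HasConductor ψ r) (β : Matrix (Fin 2) (Fin 2) (OMod O l')) : K O r l →* ℂ where
  toFun x := psiVal ψ β (x : Gr O r).val
  map_one' := by
    obtain ⟨B, hB⟩ : ∃ B : Matrix (Fin 2) (Fin 2) O, B.map (toOMod O l') = β :=
      ⟨β.map Quotient.out, by ext i j; exact Ideal.Quotient.mk_out _⟩
    rw [psiVal_eq hr hψ β (1 : K O r l).2 hB (X := 1) (by
      rw [Matrix.map_one _ (map_zero _) (map_one _), OneMemClass.coe_one, Units.val_one])]
    simp
  map_mul' x y := by
    obtain ⟨B, hB⟩ : ∃ B : Matrix (Fin 2) (Fin 2) O, B.map (toOMod O l') = β :=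
      ⟨β.map Quotient.out, by ext i j; exact Ideal.Quotient.mk_out _⟩
    have lift (z : Gr O r) : ∃ Z : Matrix (Fin 2) (Fin 2) O, Z.map (toOMod O r) = z :=
      ⟨z.val.map Quotient.out, Matrix.ext fun _ _ => Ideal.Quotient.mk_out _⟩
    obtain ⟨X, hX⟩ := lift x
    obtain ⟨Y, hY⟩ := lift y
    rw [psiVal_eq hr hψ β x.2 hB hX, psiVal_eq hr hψ β y.2 hB hY,
      psiVal_eq hr hψ β (x * y).2 hB (X := X * Y) (by
        rw [Matrix.map_mul, hX, hY]; rfl)]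
    have e : Matrix.trace (B * (X * Y - 1)) =
        Matrix.trace (B * (X - 1)) + Matrix.trace (B * (Y - 1)) +
          Matrix.trace (B * (X - 1) * (Y - 1)) := by
      rw [← Matrix.trace_add, ← Matrix.trace_add]
      congr 1
      noncomm_ring
    have m : Matrix.trace (B * (X - 1) * (Y - 1)) ∈ maximalIdeal O ^ r := by
      refine Ideal.pow_le_pow_right (show r ≤ l + l by omega) ?_
      rw [pow_add]
      refine trace_mul_mem (fun i j => ?_) (fun i j => mem_K (by omega) y.2 hY i j)
      rw [Matrix.mul_apply]
      exact Ideal.sum_mem _ fun k _ => Ideal.mul_mem_left _ _ (mem_K (by omega) x.2 hX k j)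
    rw [e, AddChar.map_add_eq_mul, AddChar.map_add_eq_mul, (hψ r).2 le_rfl _ m, mul_one]

/-- `β` is cuspidal: its characteristic polynomial is irreducible modulo `𝔭`. -/
def IsCuspidal {n : ℕ} (hn : n ≠ 0) (β : Matrix (Fin 2) (Fin 2) (OMod O n)) : Prop :=
  Irreducible (β.charpoly.map (toResidue hn))

/-- The unit group `O_r[b]ˣ` of the `O_r`-subalgebra of `M₂(O_r)` generated by `b`, as a
subgroup of `G_r`. -/
def unitsAdjoin {r : ℕ} (b : Matrix (Fin 2) (Fin 2) (OMod O r)) : Subgroup (Gr O r) :=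
  (Algebra.adjoin (OMod O r) {b}).toSubmonoid.units

/-- `Z¹ = O_r[b]ˣ ∩ K_1`. -/
def Z1 {r : ℕ} (b : Matrix (Fin 2) (Fin 2) (OMod O r)) : Subgroup (Gr O r) :=
  unitsAdjoin b ⊓ K O r 1

/-- `Z¹ K_i` (the subgroup generated by `Z¹` and the normal subgroup `K_i`). -/
def Z1K {r : ℕ} (b : Matrix (Fin 2) (Fin 2) (OMod O r)) (i : ℕ) : Subgroup (Gr O r) :=
  Z1 b ⊔ K O r i

theorem K_le_Z1K {r : ℕ} (b : Matrix (Fin 2) (Fin 2) (OMod O r)) (i : ℕ) :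
    K O r i ≤ Z1K b i := le_sup_right

theorem K_anti {r i j : ℕ} (h : i ≤ j) : K O r j ≤ K O r i := by
  intro x hx
  have hle : (maximalIdeal O ^ j).map (toOMod O r) ≤ (maximalIdeal O ^ i).map (toOMod O r) :=
    Ideal.map_mono (Ideal.pow_le_pow_right h)
  have h1 := congrArg (Matrix.GeneralLinearGroup.map (Ideal.Quotient.factor hle))
    (MonoidHom.mem_ker.1 hx)
  rw [map_one] at h1
  rw [K, MonoidHom.mem_ker, ← h1]
  ext a b
  rfl

theorem Z1K_anti {r i j : ℕ} (b : Matrix (Fin 2) (Fin 2) (OMod O r)) (h : i ≤ j) :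
    Z1K b j ≤ Z1K b i := sup_le_sup_left (K_anti h) _

/-- For a linear character `φ` of `K_l` (in the application `φ = ψ_β`): `χ` is an extension of
`φ` to `Z¹ K_l`. -/
def ExtendsChar {r l : ℕ} {b : Matrix (Fin 2) (Fin 2) (OMod O r)} (φ : K O r l →* ℂ)
    (χ : Z1K b l →* ℂ) : Prop :=
  χ.comp (Subgroup.inclusion (K_le_Z1K b l)) = φ

/-- `η` is an irreducible representation of `Z¹ K_{l'}` whose restriction to `Z¹ K_l` contains
the linear character `χ`. -/
def IsEta {r l l' : ℕ} (hl : l' ≤ l) {b : Matrix (Fin 2) (Fin 2) (OMod O r)}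
    (χ : Z1K b l →* ℂ) {V : Type*} [AddCommGroup V] [Module ℂ V]
    (η : Representation ℂ (Z1K b l') V) : Prop :=
  η.IsIrreducible ∧ Contains (η.comp (Subgroup.inclusion (Z1K_anti b hl))) (oneDim χ)

/-- For a subgroup `T ≥ Z¹ K_{l'}`: the representation `θ` of `T` extends some representation
`η` of `Z¹ K_{l'}` as in `IsEta`, where `χ` is some extension of `φ` to `Z¹ K_l`. -/
def IsEtaTilde {r l l' : ℕ} (hl : l' ≤ l) {b : Matrix (Fin 2) (Fin 2) (OMod O r)}
    (φ : K O r l →* ℂ) {T : Subgroup (Gr O r)} (hT : Z1K b l' ≤ T)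
    {V : Type*} [AddCommGroup V] [Module ℂ V] (θ : Representation ℂ T V) : Prop :=
  ∃ χ : Z1K b l →* ℂ, ExtendsChar φ χ ∧
    ∃ η : Representation ℂ (Z1K b l') V, IsEta hl χ η ∧ θ.comp (Subgroup.inclusion hT) = η

end Ring

end CuspidalGL2

end

open CuspidalGL2

universe u w

open IsLocalRing ValuativeRel
open scoped Matrix commutatorElement

noncomputable section

/-! Everything rests on one matrix computation. Conjugating `ψ_β` by `g` replaces `β` by `g⁻¹βg`,
and the trace pairing is perfect, so `g` lies in `T` exactly when it commutes with `b` modulo `𝔭 ^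
l'`. A cuspidal `b` has a cyclic vector modulo `𝔭`, so a matrix commuting with `b` modulo `𝔭 ^ l'`
is a polynomial in `b` modulo `𝔭 ^ l'`. Hence `T = O_r[b]ˣ K_{l'}`
(`exists_eq_mul_of_mem_stabilizer`).

Since `Z¹` is abelian and fixes `ψ_β`, the character extends to `χ` on `N = Z¹ K_l`. Commutators of
`K_{l'}` with `Z¹` lie in `K_l`, because `l' + 1 = l`, and `ψ_β` kills them because `Z¹` commutes
with `b`; so `T` fixes `χ`. On `K_{l'}` the commutator form is `ψ (ϖ ^ (2 l') Tr ((bX - Xb) Y))`. As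
`r - 2 l' = 1`, its radical requires `X` to commute with `b` modulo `𝔭`, which means that the
element lies in `N` (`mem_Z1K_of_forall_commutator`).

With `H = Z¹ K_{l'}`, non-degeneracy makes the character of any irreducible representation of `H`
over `χ` vanish off `N`, so there is only one such `η` (`nonempty_equiv_of_scalar`), and `T` must
stabilize it. Reduction modulo `𝔭` embeds `T / H` in the multiplicative group of the finite field
`k[b]`, so it is cyclic and `η` extends to `T` (`exists_extension`). Conversely an irreducible `θ`
of `T` over `χ` stays irreducible on `H` (`isIrreducible_comp_of_extension`). The `η̃_β` are
therefore exactly the irreducible representations of `T` on which `K_l` acts through `ψ_β`, and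
Clifford theory for the normal subgroup `K_l` yields the statements about induction to `G_r`.

The group-theoretic core assumes only a generator `ϖ` of the maximal ideal of `O / 𝔭 ^ r` with the
expected annihilators, a primitive additive character, and a unit entry `b 1 0`; the local field
enters only to supply these. -/

namespace CuspidalGL2

/-! ### Irreducible representations, eigenspaces and linear characters -/

section Irreducible

variable {G V W : Type*} [Group G] [AddCommGroup V] [Module ℂ V] [AddCommGroup W] [Module ℂ W]

theorem isIrreducible_of_forall {ρ : Representation ℂ G V} [Nontrivial V]
    (h : ∀ U : Submodule ℂ V, (∀ g, ∀ v ∈ U, ρ g v ∈ U) → U = ⊥ ∨ U = ⊤) : ρ.IsIrreducible := by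
  have : Nontrivial (Subrepresentation ρ) := by
    refine ⟨⊥, ⊤, fun h => ?_⟩
    exact bot_ne_top (α := Submodule ℂ V) (congrArg Subrepresentation.toSubmodule h)
  refine ⟨fun U => ?_⟩
  refine (h U.toSubmodule fun g v hv => U.apply_mem_toSubmodule g hv).imp ?_ ?_ <;>
  exact fun h => Subrepresentation.toSubmodule_injective h

theorem eq_bot_or_eq_top_of_isIrreducible {ρ : Representation ℂ G V} (hρ : ρ.IsIrreducible)
    (U : Submodule ℂ V) (h : ∀ g, ∀ v ∈ U, ρ g v ∈ U) : U = ⊥ ∨ U = ⊤ := by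
  have := hρ.eq_bot_or_eq_top ⟨U, fun g v hv => h g v hv⟩
  exact this.imp (congrArg Subrepresentation.toSubmodule) (congrArg Subrepresentation.toSubmodule)

theorem nontrivial_of_isIrreducible {ρ : Representation ℂ G V} (hρ : ρ.IsIrreducible) :
    Nontrivial V := by
  by_contra h
  rw [not_nontrivial_iff_subsingleton] at h
  obtain ⟨a, b, hab⟩ := hρ.toNontrivial
  exact hab (Subrepresentation.toSubmodule_injective (Subsingleton.elim _ _))

theorem isIrreducible_of_comp {H : Type*} [Group H] {ρ : Representation ℂ G V} (i : H →* G)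
    (h : Representation.IsIrreducible (ρ.comp i)) : ρ.IsIrreducible := by
  have := nontrivial_of_isIrreducible h
  exact isIrreducible_of_forall fun U hU =>
    eq_bot_or_eq_top_of_isIrreducible h U fun g v hv => hU (i g) v hv

theorem isIrreducible_of_bijective {ρ : Representation ℂ G V} {σ : Representation ℂ G W}
    (hρ : ρ.IsIrreducible) (f : V →ₗ[ℂ] W) (hf : Function.Bijective f)
    (h : ∀ g v, f (ρ g v) = σ g (f v)) : σ.IsIrreducible := by
  have := nontrivial_of_isIrreducible hρ
  have : Nontrivial W := hf.1.nontrivial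
  refine isIrreducible_of_forall fun U hU => ?_
  have hmap : (U.comap f).map f = U := Submodule.map_comap_eq_of_surjective hf.2 U
  refine (eq_bot_or_eq_top_of_isIrreducible hρ (U.comap f) fun g v hv => ?_).imp ?_ ?_
  · rw [Submodule.mem_comap, h]
    exact hU g _ hv
  · intro h0
    rw [← hmap, h0, Submodule.map_bot]
  · intro h0
    rw [← hmap, h0, Submodule.map_top, LinearMap.range_eq_top.2 hf.2]

/-- The span of the orbit of a vector. -/
def orbitSpan (ρ : Representation ℂ G V) (v : V) : Subrepresentation ρ where
  toSubmodule := Submodule.span ℂ (Set.range fun g => ρ g v)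
  apply_mem_toSubmodule g w hw := by
    induction hw using Submodule.span_induction with
    | mem x hx =>
      obtain ⟨h, rfl⟩ := hx
      refine Submodule.subset_span ⟨g * h, ?_⟩
      simp
    | zero => simp
    | add x y _ _ hx hy => rw [map_add]; exact add_mem hx hy
    | smul a x _ hx => rw [map_smul]; exact Submodule.smul_mem _ _ hx

theorem mem_orbitSpan (ρ : Representation ℂ G V) (v : V) : v ∈ (orbitSpan ρ v).toSubmodule :=
  Submodule.subset_span ⟨1, by simp⟩

instance [Finite G] (ρ : Representation ℂ G V) (v : V) :
    FiniteDimensional ℂ (orbitSpan ρ v).toSubmodule :=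
  FiniteDimensional.span_of_finite ℂ (Set.finite_range _)

theorem finiteDimensional_of_isIrreducible [Finite G] {ρ : Representation ℂ G V}
    (hρ : ρ.IsIrreducible) : FiniteDimensional ℂ V := by
  have := nontrivial_of_isIrreducible hρ
  obtain ⟨v, hv⟩ := exists_ne (0 : V)
  have h := (eq_bot_or_eq_top_of_isIrreducible hρ (orbitSpan ρ v).toSubmodule
    fun g w hw => (orbitSpan ρ v).apply_mem_toSubmodule g hw).resolve_left fun h =>
      hv ((Submodule.mem_bot ℂ).1 (h ▸ mem_orbitSpan ρ v))
  have h2 : FiniteDimensional ℂ (orbitSpan ρ v).toSubmodule := inferInstance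
  rw [h] at h2
  exact Module.finite_def.2 ((Submodule.fg_top _).1 (Module.finite_def.1 h2) )

/-- Orbit spans are finite dimensional, so a nonzero invariant subspace of least finite dimension
exists even when `V` is infinite dimensional. -/
theorem exists_isIrreducible_toRepresentation [Finite G] [Nontrivial V]
    (ρ : Representation ℂ G V) :
    ∃ U : Subrepresentation ρ, U.toRepresentation.IsIrreducible := by
  let S : Set (Subrepresentation ρ) :=
    {U | U.toSubmodule ≠ ⊥ ∧ FiniteDimensional ℂ U.toSubmodule}
  have hS : S.Nonempty := by
    obtain ⟨v, hv⟩ := exists_ne (0 : V)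
    exact ⟨orbitSpan ρ v, fun h => hv ((Submodule.mem_bot ℂ).1 (h ▸ mem_orbitSpan ρ v)),
      inferInstance⟩
  obtain ⟨U, ⟨hU0, hUf⟩, hmin⟩ :=
    (measure fun U : Subrepresentation ρ => Module.finrank ℂ U.toSubmodule).wf.has_min S hS
  refine ⟨U, ?_⟩
  have : Nontrivial U.toSubmodule := Submodule.nontrivial_iff_ne_bot.2 hU0
  refine isIrreducible_of_forall fun X hX => or_iff_not_imp_left.2 fun hX0 => ?_
  let X' : Subrepresentation ρ := ⟨X.map U.toSubmodule.subtype, by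
    rintro g _ ⟨v, hv, rfl⟩
    exact ⟨_, hX g v hv, rfl⟩⟩
  have hXf : FiniteDimensional ℂ X'.toSubmodule :=
    inferInstanceAs (FiniteDimensional ℂ (X.map U.toSubmodule.subtype))
  have h1 := hmin X' ⟨fun h => hX0 (Submodule.map_injective_of_injective
    (Submodule.injective_subtype _) (h.trans (Submodule.map_bot _).symm)), hXf⟩
  have h2 : Module.finrank ℂ X'.toSubmodule = Module.finrank ℂ X :=
    LinearEquiv.finrank_eq (Submodule.equivSubtypeMap _ _).symm
  refine Submodule.eq_top_of_finrank_eq (le_antisymm (Submodule.finrank_le X) ?_)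
  rw [← h2]
  exact not_lt.1 h1

/-- The representation obtained from `ρ` by transport of structure along a linear equivalence. -/
def transport (ρ : Representation ℂ G V) (e : V ≃ₗ[ℂ] W) : Representation ℂ G W where
  toFun g := e.toLinearMap ∘ₗ ρ g ∘ₗ e.symm.toLinearMap
  map_one' := by ext; simp
  map_mul' x y := by ext; simp

theorem transport_apply (ρ : Representation ℂ G V) (e : V ≃ₗ[ℂ] W) (g : G) (w : W) :
    transport ρ e g w = e (ρ g (e.symm w)) := rfl

/-- Vectors on which each `f i` acts by the scalar `c i`. -/
def eigenspace {ι : Type*} (ρ : Representation ℂ G V) (f : ι → G) (c : ι → ℂ) :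
    Submodule ℂ V where
  carrier := {v | ∀ i, ρ (f i) v = c i • v}
  add_mem' hv hw i := by rw [map_add, hv i, hw i, smul_add]
  zero_mem' i := by simp
  smul_mem' a v hv i := by rw [map_smul, hv i, smul_comm]

theorem apply_mem_eigenspace {ι : Type*} {ρ : Representation ℂ G V} {f : ι → G} {c : ι → ℂ}
    {g : G} (h : ∀ i, ∃ j, f i * g = g * f j ∧ c j = c i) {v : V}
    (hv : v ∈ eigenspace ρ f c) : ρ g v ∈ eigenspace ρ f c := by
  intro i
  obtain ⟨j, hj, hc⟩ := h i
  rw [← Module.End.mul_apply, ← map_mul, hj, map_mul, Module.End.mul_apply, hv j, map_smul, hc]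

/-- The hypothesis `h` says that conjugation carries the eigenvalue conditions to one another, so
the eigenspace is invariant. -/
theorem eigenspace_eq_top {ι : Type*} {ρ : Representation ℂ G V} (hρ : ρ.IsIrreducible)
    {f : ι → G} {c : ι → ℂ} (h : ∀ g i, ∃ j, f i * g = g * f j ∧ c j = c i) {v : V}
    (hv : v ≠ 0) (hv' : v ∈ eigenspace ρ f c) : eigenspace ρ f c = ⊤ :=
  (eq_bot_or_eq_top_of_isIrreducible hρ _ fun g _ hw =>
    apply_mem_eigenspace (h g) hw).resolve_left fun h0 => hv ((Submodule.mem_bot ℂ).1 (h0 ▸ hv'))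

theorem contains_oneDim_iff {ρ : Representation ℂ G V} {χ : G →* ℂ} :
    Contains ρ (oneDim χ) ↔ ∃ v ≠ 0, ∀ g, ρ g v = χ g • v := by
  constructor
  · rintro ⟨f, hf⟩
    refine ⟨f 1, fun h => one_ne_zero (hf (h.trans (map_zero f).symm)), fun g => ?_⟩
    rw [← f.isIntertwining, ← map_smul]
    rfl
  · rintro ⟨v, hv, h⟩
    refine ⟨⟨LinearMap.toSpanSingleton ℂ V v, fun g => ?_⟩, ?_⟩
    · ext
      simp [oneDim, h]
    · exact fun a b hab => smul_left_injective ℂ hv hab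

theorem mem_stabilizer_oneDim {K : Subgroup G} {χ : K →* ℂ} {g : G} :
    g ∈ stabilizer (oneDim χ) ↔ (∀ x, x ∈ K ↔ g * x * g⁻¹ ∈ K) ∧
      ∀ x y : K, (y : G) = g * x * g⁻¹ → χ x = χ y := by
  refine and_congr_right fun _ => ⟨?_, fun h => ⟨LinearEquiv.refl ℂ ℂ, fun x y hxy v => ?_⟩⟩
  · rintro ⟨e, he⟩ x y hxy
    have h1 := he x y hxy 1
    have h2 : e (oneDim χ x 1) = χ x • e 1 := by
      rw [← map_smul]; rfl
    rw [h2] at h1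
    exact mul_right_cancel₀ (e.map_ne_zero_iff.2 one_ne_zero) h1
  · simp [oneDim, h x y hxy]

end Irreducible

/-! ### Uniqueness of the Heisenberg representation -/

section Heisenberg

variable {H N V W : Type*} [Group H] [Group N] [AddCommGroup V] [Module ℂ V]
  [AddCommGroup W] [Module ℂ W] (i : N →* H) (χ : N →* ℂ)

/-- Conjugating `x` by `y` multiplies it by `⁅y, x⁆`, which acts by the scalar `χ n ≠ 1`; the trace
is unchanged by conjugation, so it vanishes. -/
theorem character_eq_zero_of_not_mem_range {η : Representation ℂ H V}
    (hη : ∀ n v, η (i n) v = χ n • v) {x : H} (hx : ∃ (y : H) (n : N), i n = ⁅y, x⁆ ∧ χ n ≠ 1) :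
    η.character x = 0 := by
  obtain ⟨y, n, hn, hχ⟩ := hx
  have h1 : y * x * y⁻¹ = i n * x := by rw [hn, commutatorElement_def]; group
  have h2 : η.character (i n * x) = χ n * η.character x := by
    rw [Representation.character, map_mul,
      show η (i n) = χ n • LinearMap.id from LinearMap.ext (hη n)]
    rw [Module.End.mul_eq_comp, LinearMap.smul_comp, LinearMap.id_comp, map_smul, smul_eq_mul,
      Representation.character]
  rw [← h1, Representation.char_conj] at h2
  by_contra h0
  exact hχ (mul_right_cancel₀ h0 (by rw [← h2, one_mul]))

/-- Both characters are supported on the image of `N`, where they are positive multiples of `χ`.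
Their inner product is then nonzero, which contradicts orthogonality of inequivalent irreducible
characters. -/
theorem nonempty_equiv_of_scalar [Finite H]
    (hi : ∀ x, x ∉ i.range → ∃ (y : H) (n : N), i n = ⁅y, x⁆ ∧ χ n ≠ 1)
    {η : Representation ℂ H V} {η' : Representation ℂ H W}
    (hirr : η.IsIrreducible) (hirr' : η'.IsIrreducible)
    (hη : ∀ n v, η (i n) v = χ n • v) (hη' : ∀ n v, η' (i n) v = χ n • v) :
    Nonempty (Representation.Equiv η η') := by
  classical
  have := Fintype.ofFinite H
  have := finiteDimensional_of_isIrreducible hirr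
  have := finiteDimensional_of_isIrreducible hirr'
  have := nontrivial_of_isIrreducible hirr
  have := nontrivial_of_isIrreducible hirr'
  have hcard : (Nat.card H : ℂ) ≠ 0 := Nat.cast_ne_zero.2 Nat.card_pos.ne'
  have := invertibleOfNonzero hcard
  by_contra h0
  have h := Representation.char_orthonormal η' η
  rw [if_neg h0, mul_eq_zero, or_iff_right (inv_ne_zero hcard)] at h
  have hsum : ∀ g : H, η'.character g * η.character g⁻¹ =
      if g ∈ i.range then (Module.finrank ℂ W * Module.finrank ℂ V : ℂ) else 0 := by
    intro g
    split_ifs with hg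
    · obtain ⟨n, rfl⟩ := hg
      rw [← map_inv, Representation.character, Representation.character,
        show η (i n⁻¹) = χ n⁻¹ • LinearMap.id from LinearMap.ext (hη _),
        show η' (i n) = χ n • LinearMap.id from LinearMap.ext (hη' _)]
      simp only [map_smul, LinearMap.trace_id, smul_eq_mul]
      have : χ n * χ n⁻¹ = 1 := by rw [← map_mul, mul_inv_cancel, map_one]
      linear_combination (Module.finrank ℂ W * Module.finrank ℂ V : ℂ) * this
    · rw [character_eq_zero_of_not_mem_range i χ hη' (hi g hg), zero_mul]
  rw [Finset.sum_congr rfl fun g _ => hsum g, ← Finset.sum_filter, Finset.sum_const,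
    smul_eq_zero] at h
  rcases h with h | h
  · exact (Finset.card_pos.2 ⟨1, by simp [-MonoidHom.mem_range, one_mem]⟩).ne' h
  · simp [Module.finrank_pos.ne'] at h

end Heisenberg

/-! ### Extension and restriction along a cyclic quotient -/

section CyclicExtension

variable {X H V W : Type*} [Group X] [Group H] [AddCommGroup V] [Module ℂ V]
  [AddCommGroup W] [Module ℂ W]

theorem exists_smul_of_comm {η : Representation ℂ H V} (hη : η.IsIrreducible)
    [FiniteDimensional ℂ V] (f : V →ₗ[ℂ] V) (hf : ∀ h v, f (η h v) = η h (f v)) :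
    ∃ c : ℂ, ∀ v, f v = c • v := by
  have : η.IsIrreducible := hη
  obtain ⟨c, hc⟩ := (Representation.IsIrreducible.algebraMap_intertwiningMap_bijective_of_isAlgClosed
    (ρ := η)).2 ⟨f, fun h => LinearMap.ext fun v => hf h v⟩
  refine ⟨c, fun v => ?_⟩
  have := congrArg (fun g : Representation.IntertwiningMap η η => g v) hc
  simpa using this.symm

/-- Pairs of an element `x` of `X` and an operator intertwining `η` with its conjugate by `x`. -/
def intertwiners {i : H →* X} (hi : Function.Injective i) (η : Representation ℂ H V)
    (hn : ∀ x h, ∃ h', i h' = x * i h * x⁻¹) : Subgroup (X × (V →ₗ[ℂ] V)ˣ) where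
  carrier := {p | ∀ h h', i h' = p.1 * i h * p.1⁻¹ → p.2.val * η h = η h' * p.2.val}
  one_mem' h h' hh := by
    obtain rfl : h' = h := hi (by simpa using hh)
    simp
  mul_mem' := by
    rintro ⟨x, e⟩ ⟨y, f⟩ hx hy h h'' hh
    obtain ⟨h', hh'⟩ := hn y h
    have h1 := hy h h' hh'
    have h2 := hx h' h'' (by rw [hh, hh']; simp [mul_assoc])
    simp only [Prod.mk_mul_mk, Units.val_mul] at h1 h2 ⊢
    rw [mul_assoc, h1, ← mul_assoc, h2, mul_assoc]
  inv_mem' := by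
    rintro ⟨x, e⟩ hx h h' hh
    have h1 := hx h' h (by simp only [Prod.fst_inv] at hh; rw [hh]; group)
    simp only [Prod.snd_inv] at h1 ⊢
    rw [Units.inv_mul_eq_iff_eq_mul, ← mul_assoc, h1, mul_assoc, Units.mul_inv, mul_one]

/-- An operator implementing conjugation by `c` is determined up to a scalar. Rescaling it makes its
`N`-th power correct, where `N` is the order of `c` modulo `H`, and all relations between powers of
`c` and `H` follow from this one. -/
theorem exists_zpow_extension [Finite X] {i : H →* X} (hi : Function.Injective i)
    (hn : ∀ x h, ∃ h', i h' = x * i h * x⁻¹) {η : Representation ℂ H V} (hη : η.IsIrreducible)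
    (c : X) (hst : ∃ e : (V →ₗ[ℂ] V)ˣ, (c, e) ∈ intertwiners hi η hn) :
    ∃ e : (V →ₗ[ℂ] V)ˣ, (c, e) ∈ intertwiners hi η hn ∧
      ∀ (n : ℤ) (h : H), i h = c ^ n → (e ^ n).val = η h := by
  have : Finite H := Finite.of_injective i hi
  have := finiteDimensional_of_isIrreducible hη
  have := nontrivial_of_isIrreducible hη
  obtain ⟨e, he⟩ := hst
  let Z : AddSubgroup ℤ :=
    { carrier := {n | c ^ n ∈ i.range}
      zero_mem' := by simp [-MonoidHom.mem_range, one_mem]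
      add_mem' := fun {a b} ha hb => by
        simp only [Set.mem_ofPred_eq] at ha hb ⊢
        rw [zpow_add]
        exact mul_mem ha hb
      neg_mem' := fun {a} ha => by
        simp only [Set.mem_ofPred_eq] at ha ⊢
        rw [zpow_neg]
        exact inv_mem ha }
  obtain ⟨a, ha⟩ := Int.subgroup_cyclic Z
  have haZ : a ∈ Z := ha ▸ AddSubgroup.mem_closure_singleton_self a
  have hdvd : ∀ n ∈ Z, ((a.natAbs : ℕ) : ℤ) ∣ n := by
    intro n hn
    rw [ha, AddSubgroup.mem_closure_singleton] at hn
    obtain ⟨k, rfl⟩ := hn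
    rw [Int.natAbs_dvd]
    exact ⟨k, by rw [smul_eq_mul, mul_comm]⟩
  have hNZ : ((a.natAbs : ℕ) : ℤ) ∈ Z := by
    rcases Int.natAbs_eq a with h | h
    · rwa [← h]
    · rw [← neg_neg ((a.natAbs : ℕ) : ℤ), ← h]
      exact neg_mem haZ
  have hN : 0 < a.natAbs := by
    have h1 : (orderOf c : ℤ) ∈ Z := by
      change c ^ (orderOf c : ℤ) ∈ i.range
      rw [zpow_natCast, pow_orderOf_eq_one]
      exact one_mem _
    have h2 := hdvd _ h1
    refine Nat.pos_of_ne_zero fun h0 => ?_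
    rw [h0, Nat.cast_zero, zero_dvd_iff, Nat.cast_eq_zero] at h2
    exact (orderOf_pos c).ne' h2
  generalize a.natAbs = N at hdvd hNZ hN
  obtain ⟨h0, hh0⟩ := hNZ
  rw [zpow_natCast] at hh0
  have heN := Subgroup.pow_mem _ he N
  -- Both `e ^ N` and `η h0` implement conjugation by `c ^ N = i h0`, so by Schur's lemma they
  -- differ by a scalar `μ`; an `N`-th root of `μ⁻¹` corrects `e`.
  obtain ⟨μ, hμ⟩ := exists_smul_of_comm hη (η h0⁻¹ * (e ^ N).val) fun h v => by
    have h1 := heN h (h0 * h * h0⁻¹) (by simp [hh0])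
    have h2 : η h0⁻¹ * ((e ^ N).val * η h) = η h * (η h0⁻¹ * (e ^ N).val) := by
      change (e ^ N).val * η h = _ at h1
      rw [h1, ← mul_assoc, ← mul_assoc, ← map_mul, ← map_mul]
      change _ * (e ^ N).val = _
      congr 2
      group
    exact LinearMap.congr_fun h2 v
  have hμ' : (e ^ N).val = algebraMap ℂ (V →ₗ[ℂ] V) μ * η h0 := by
    rw [Algebra.commutes, ← one_mul (e ^ N).val, ← map_one η, ← mul_inv_cancel h0, map_mul,
      mul_assoc]
    congr 1
    exact LinearMap.ext hμ
  have hμ0 : μ ≠ 0 := by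
    rintro rfl
    rw [map_zero, zero_mul] at hμ'
    exact (e ^ N).ne_zero hμ'
  obtain ⟨z, hz⟩ := IsAlgClosed.exists_pow_nat_eq μ⁻¹ hN
  have hz0 : z ≠ 0 := by
    rintro rfl
    rw [zero_pow hN.ne'] at hz
    exact inv_ne_zero hμ0 hz.symm
  let e' : (V →ₗ[ℂ] V)ˣ := Units.map (algebraMap ℂ (V →ₗ[ℂ] V)).toMonoidHom (Units.mk0 z hz0) * e
  have he'v : e'.val = algebraMap ℂ (V →ₗ[ℂ] V) z * e.val := rfl
  have he'N : (e' ^ N).val = η h0 := by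
    rw [Units.val_pow_eq_pow_val, he'v, Commute.mul_pow (Algebra.commutes z e.val), ← map_pow,
      hz, ← Units.val_pow_eq_pow_val, hμ', ← mul_assoc, ← map_mul, inv_mul_cancel₀ hμ0, map_one,
      one_mul]
  refine ⟨e', fun h h' hh => ?_, fun n h hh => ?_⟩
  · have h1 := he h h' hh
    simp only at h1 ⊢
    rw [he'v, mul_assoc, h1, ← mul_assoc, ← mul_assoc, Algebra.commutes]
  · obtain ⟨k, rfl⟩ := hdvd n ⟨h, hh⟩
    have h1 : h = h0 ^ k := hi (by rw [hh, map_zpow, hh0, zpow_mul, zpow_natCast])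
    have h2 : e' ^ N = Units.map η (toUnits h0) := Units.ext he'N
    rw [h1, zpow_mul, zpow_natCast, h2, ← map_zpow, ← map_zpow]
    rfl

/-- The extension is `c ^ n * i h ↦ e ^ n * η h`, with `e` normalized as in `exists_zpow_extension`.
-/
theorem exists_extension [Finite X] {i : H →* X} (hi : Function.Injective i)
    (hn : ∀ x h, ∃ h', i h' = x * i h * x⁻¹) {η : Representation ℂ H V} (hη : η.IsIrreducible)
    (c : X) (hc : ∀ x, ∃ (n : ℤ) (h : H), x = c ^ n * i h)
    (hst : ∃ e : (V →ₗ[ℂ] V)ˣ, (c, e) ∈ intertwiners hi η hn) :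
    ∃ θ : Representation ℂ X V, θ.comp i = η := by
  obtain ⟨e, he, hen⟩ := exists_zpow_extension hi hn hη c hst
  choose n h hnh using hc
  -- Independence of the chosen decomposition: two of them differ by an element of `⟨c⟩ ∩ H`, on
  -- which `e` and `η` agree.
  have key : ∀ (m : ℤ) (k : H), (e ^ n (c ^ m * i k)).val * η (h (c ^ m * i k)) =
      (e ^ m).val * η k := by
    intro m k
    set x := c ^ m * i k with hx
    have h1 : i (h x * k⁻¹) = c ^ (m - n x) := by
      have := hnh x
      rw [map_mul, map_inv, mul_inv_eq_iff_eq_mul, sub_eq_neg_add, zpow_add, zpow_neg, mul_assoc,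
        ← hx, eq_inv_mul_iff_mul_eq, ← this]
    have h2 := hen _ _ h1
    have h3 : η (h x) = η (h x * k⁻¹) * η k := by rw [← map_mul, inv_mul_cancel_right]
    rw [h3, ← h2, ← mul_assoc, ← Units.val_mul, ← zpow_add, add_sub_cancel]
  refine ⟨⟨⟨fun x => (e ^ n x).val * η (h x), ?_⟩, fun x y => ?_⟩, ?_⟩
  · simpa using key 0 1
  · obtain ⟨k, hk⟩ := hn (c ^ (-n y)) (h x)
    have h1 : x * y = c ^ (n x + n y) * i (k * h y) := by
      conv_lhs => rw [hnh x, hnh y]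
      rw [map_mul, hk, zpow_add]
      group
    have h2 := key (n x + n y) (k * h y)
    rw [← h1] at h2
    have h3 := Subgroup.zpow_mem _ he (-n y) (h x) k hk
    change (e ^ (-n y)).val * η (h x) = η k * (e ^ (-n y)).val at h3
    simp only [h2, map_mul, zpow_add, Units.val_mul]
    have h4 : (e ^ n y).val * η k = η (h x) * (e ^ n y).val := by
      rw [zpow_neg, Units.inv_mul_eq_iff_eq_mul, ← mul_assoc] at h3
      rw [h3, mul_assoc, ← Units.val_mul, inv_mul_cancel, Units.val_one, mul_one]
    simp only [mul_assoc]
    rw [← mul_assoc _ (η k), h4]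
    simp only [mul_assoc]
  · ext k : 1
    simpa using key 0 k

/-- Conjugation by `c` acts on the nonzero finite-dimensional space of `H`-maps from `η` to `θ`. An
eigenvector there commutes with `c` up to a scalar, so its image is stable under `X`; it is thus an
isomorphism of `H`-representations. -/
theorem isIrreducible_comp_of_extension [Finite X] {i : H →* X}
    (hn : ∀ x h, ∃ h', i h' = x * i h * x⁻¹)
    (c : X) (hc : ∀ x, ∃ (n : ℤ) (h : H), x = c ^ n * i h)
    {η : Representation ℂ X V} (hη : Representation.IsIrreducible (η.comp i))
    {θ : Representation ℂ X W} (hθ : θ.IsIrreducible)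
    (f : V →ₗ[ℂ] W) (hf0 : f ≠ 0) (hf : ∀ h v, f (η (i h) v) = θ (i h) (f v)) :
    Representation.IsIrreducible (θ.comp i) := by
  have := finiteDimensional_of_isIrreducible hθ
  have := finiteDimensional_of_isIrreducible (isIrreducible_of_comp i hη)
  let M : Submodule ℂ (V →ₗ[ℂ] W) :=
    { carrier := {f | ∀ h v, f (η (i h) v) = θ (i h) (f v)}
      add_mem' := fun ha hb h v => by simp [ha h v, hb h v]
      zero_mem' := fun h v => by simp
      smul_mem' := fun a f hf h v => by simp [hf h v] }
  have : Nontrivial M := ⟨⟨f, hf⟩, 0, fun h => hf0 (congrArg Subtype.val h)⟩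
  let A : (V →ₗ[ℂ] W) →ₗ[ℂ] (V →ₗ[ℂ] W) :=
    { toFun := fun f => θ c ∘ₗ f ∘ₗ η c⁻¹
      map_add' := fun a b => by ext; simp
      map_smul' := fun a b => by ext; simp }
  have hA : ∀ g ∈ M, A g ∈ M := by
    intro g hg h v
    obtain ⟨h', hh'⟩ := hn c⁻¹ h
    have h1 : c⁻¹ * i h = i h' * c⁻¹ := by rw [hh']; group
    have h2 : i h * c = c * i h' := by rw [hh']; group
    change θ c (g (η c⁻¹ (η (i h) v))) = θ (i h) (θ c (g (η c⁻¹ v)))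
    rw [← Module.End.mul_apply, ← map_mul, h1, map_mul, Module.End.mul_apply, hg,
      ← Module.End.mul_apply, ← Module.End.mul_apply, ← map_mul, ← map_mul, h2]
  obtain ⟨a, ha⟩ := Module.End.exists_eigenvalue (A.restrict hA)
  obtain ⟨⟨g, hgM⟩, hg⟩ := ha.exists_hasEigenvector
  have hg0 : g ≠ 0 := fun h => hg.2 (Subtype.ext h)
  have hgA : ∀ v, θ c (g v) = a • g (η c v) := by
    intro v
    have := congrArg (fun f : M => f.val (η c v)) hg.apply_eq_smul
    change θ c (g (η c⁻¹ (η c v))) = a • g (η c v) at this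
    rwa [← Module.End.mul_apply, ← map_mul, inv_mul_cancel, map_one] at this
  have hstab : ∀ x, ∀ w ∈ LinearMap.range g, θ x w ∈ LinearMap.range g := by
    have hpow : ∀ n : ℕ, ∀ w ∈ LinearMap.range g, θ (c ^ n) w ∈ LinearMap.range g := by
      intro n
      induction n with
      | zero => simp
      | succ n ih =>
        rintro _ ⟨v, rfl⟩
        rw [pow_succ, map_mul, Module.End.mul_apply, hgA, ← map_smul]
        exact ih _ ⟨_, rfl⟩
    rintro x _ ⟨v, rfl⟩
    obtain ⟨n, h, rfl⟩ := hc x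
    -- As `c` has finite order, natural powers suffice, and the inverse of the eigenvalue is never
    -- needed.
    obtain ⟨m, hm⟩ := (mem_powers_iff_mem_zpowers (x := c) (y := c ^ n)).2 ⟨n, rfl⟩
    rw [map_mul, Module.End.mul_apply, ← hgM, ← hm]
    exact hpow m _ ⟨_, rfl⟩
  have hsurj : Function.Surjective g := by
    rw [← LinearMap.range_eq_top]
    refine (eq_bot_or_eq_top_of_isIrreducible hθ _ hstab).resolve_left fun h => hg0 ?_
    exact LinearMap.range_eq_bot.1 h
  have hinj : Function.Injective g := by
    rw [← LinearMap.ker_eq_bot]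
    refine (eq_bot_or_eq_top_of_isIrreducible hη _ fun h v hv => ?_).resolve_right fun h =>
      hg0 (LinearMap.ker_eq_top.1 h)
    rw [LinearMap.mem_ker] at hv ⊢
    exact (hgM h v).trans (by rw [hv, map_zero])
  exact isIrreducible_of_bijective hη g ⟨hinj, hsurj⟩ hgM

end CyclicExtension

/-! ### Induced representations as coinvariants -/

section Induction

open Representation

variable {G H V W : Type*} [Group G] [Group H] [AddCommGroup V] [Module ℂ V]
  [AddCommGroup W] [Module ℂ W]

/-- The induced space is the coinvariants of `ℂ[G] ⊗ V`, with `H` acting by left translation on the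
first factor; `G` acts by right translation by inverses. Hence the coset `H g` indexes the block of
vectors `IndV.mk i ρ g v`. -/
theorem indV_mk_apply_mul (i : H →* G) (ρ : Representation ℂ H V) (h : H) (g : G) (v : V) :
    IndV.mk i ρ (i h * g) v = IndV.mk i ρ g (ρ h⁻¹ v) := by
  have h1 := Coinvariants.mk_self_apply (Representation.tprod ((leftRegular ℂ G).comp i) ρ) h
    (TensorProduct.tmul ℂ (MonoidAlgebra.single g 1) (ρ h⁻¹ v))
  refine Eq.trans ?_ h1
  simp [IndV.mk]

/-- A linear map out of an induced representation. -/
def indLift (i : H →* G) (ρ : Representation ℂ H V) (F : G → V →ₗ[ℂ] W)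
    (hF : ∀ h g v, F (i h * g) (ρ h v) = F g v) : IndV i ρ →ₗ[ℂ] W :=
  Coinvariants.lift _
    (TensorProduct.lift ((Finsupp.lift _ _ _ F) ∘ₗ (MonoidAlgebra.coeffLinearEquiv ℂ).toLinearMap))
    fun h ↦ by
      ext g v
      simp [hF]

theorem indLift_mk (i : H →* G) (ρ : Representation ℂ H V) (F : G → V →ₗ[ℂ] W)
    (hF : ∀ h g v, F (i h * g) (ρ h v) = F g v) (g : G) (v : V) :
    indLift i ρ F hF (IndV.mk i ρ g v) = F g v := by
  simp [indLift]

theorem indV_induction {i : H →* G} {ρ : Representation ℂ H V} (U : Submodule ℂ (IndV i ρ))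
    (h : ∀ g v, IndV.mk i ρ g v ∈ U) : U = ⊤ := by
  have : U.mkQ = 0 := by
    refine IndV.hom_ext (φ := i) (ρ := ρ) fun g => LinearMap.ext fun v => ?_
    exact (Submodule.Quotient.mk_eq_zero U).2 (h g v)
  rw [← Submodule.ker_mkQ U, this, LinearMap.ker_zero]

/-- A left inverse is the map that sends the class of `g ⊗ v` to `ρ h⁻¹ v` if `g = i h`, and to `0`
if `g` is outside `H`. -/
theorem indV_mk_one_injective {i : H →* G} (hi : Function.Injective i)
    (ρ : Representation ℂ H V) : Function.Injective (IndV.mk i ρ 1) := by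
  classical
  let F : G → V →ₗ[ℂ] V := fun g => if hg : ∃ h, i h = g then ρ hg.choose⁻¹ else 0
  have hF1 : ∀ h, F (i h) = ρ h⁻¹ := by
    intro h
    have hg : ∃ h', i h' = i h := ⟨h, rfl⟩
    have h1 : hg.choose = h := hi hg.choose_spec
    simp only [F, dif_pos hg, h1]
  have hF : ∀ h g v, F (i h * g) (ρ h v) = F g v := by
    intro h g v
    by_cases hg : ∃ k, i k = g
    · obtain ⟨k, rfl⟩ := hg
      rw [← map_mul, hF1, hF1, ← Module.End.mul_apply, ← map_mul, mul_inv_rev, inv_mul_cancel_right]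
    · have hg' : ¬ ∃ k, i k = i h * g := by
        rintro ⟨k, hk⟩
        exact hg ⟨h⁻¹ * k, by rw [map_mul, hk, map_inv, inv_mul_cancel_left]⟩
      simp only [F, dif_neg hg, dif_neg hg', LinearMap.zero_apply]
  refine Function.LeftInverse.injective (g := indLift i ρ F hF) fun v => ?_
  rw [indLift_mk, ← map_one i, hF1, inv_one, map_one, Module.End.one_apply]

theorem indLift_comm (i : H →* G) (ρ : Representation ℂ H V) (π : Representation ℂ G W)
    (f : V →ₗ[ℂ] W) (hf : ∀ h v, f (ρ h v) = π (i h) (f v)) (h : H) (g : G) (v : V) :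
    (π (i h * g)⁻¹ ∘ₗ f) (ρ h v) = (π g⁻¹ ∘ₗ f) v := by
  simp [hf, ← Module.End.mul_apply, ← map_mul]

/-- Frobenius reciprocity. -/
def indHom (i : H →* G) (ρ : Representation ℂ H V) (π : Representation ℂ G W) (f : V →ₗ[ℂ] W)
    (hf : ∀ h v, f (ρ h v) = π (i h) (f v)) : IntertwiningMap (ind i ρ) π where
  toLinearMap := indLift i ρ (fun g => π g⁻¹ ∘ₗ f) (indLift_comm i ρ π f hf)
  isIntertwining' g := by
    refine IndV.hom_ext (φ := i) (ρ := ρ) fun g' => LinearMap.ext fun v => ?_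
    change indLift i ρ _ (indLift_comm i ρ π f hf) (ind i ρ g (IndV.mk i ρ g' v)) =
      π g (indLift i ρ _ (indLift_comm i ρ π f hf) (IndV.mk i ρ g' v))
    rw [ind_mk, indLift_mk, indLift_mk]
    simp

theorem indHom_mk_one (i : H →* G) (ρ : Representation ℂ H V) (π : Representation ℂ G W)
    (f : V →ₗ[ℂ] W) (hf : ∀ h v, f (ρ h v) = π (i h) (f v)) (v : V) :
    indHom i ρ π f hf (IndV.mk i ρ 1 v) = f v := by
  change indLift i ρ _ (indLift_comm i ρ π f hf) (IndV.mk i ρ 1 v) = f v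
  rw [indLift_mk]
  simp

theorem ind_mk_one_apply (i : H →* G) (ρ : Representation ℂ H V) (h : H) (v : V) :
    ind i ρ (i h) (IndV.mk i ρ 1 v) = IndV.mk i ρ 1 (ρ h v) := by
  have := indV_mk_apply_mul i ρ h⁻¹ 1 v
  rw [inv_inv, mul_one, map_inv] at this
  rw [ind_mk, one_mul, this]

/-- A stable character of a normal subgroup acts by scalars on the representation it induces. -/
theorem ind_oneDim_apply (i : H →* G) (χ : H →* ℂ)
    (hst : ∀ g h, ∃ h', i h' = g * i h * g⁻¹ ∧ χ h' = χ h) (h : H) (u : IndV i (oneDim χ)) :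
    ind i (oneDim χ) (i h) u = χ h • u := by
  have : LinearMap.ker (ind i (oneDim χ) (i h) - χ h • LinearMap.id) = ⊤ := by
    refine indV_induction _ fun g v => ?_
    rw [LinearMap.mem_ker, LinearMap.sub_apply, sub_eq_zero, ind_mk]
    obtain ⟨h', hh, hχ⟩ := hst g h
    have h1 : g * (i h)⁻¹ = i h'⁻¹ * g := by rw [map_inv, hh]; group
    rw [h1, indV_mk_apply_mul, inv_inv, ← hχ]
    exact map_smul (IndV.mk i (oneDim χ) g) (χ h') v
  have h2 := LinearMap.ker_eq_top.1 this
  exact sub_eq_zero.1 (LinearMap.congr_fun h2 u)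

/-- Any irreducible subrepresentation of the representation induced from `χ` will do, since `H` acts
on all of it by `χ`. -/
theorem exists_isIrreducible_scalar.{v} [Finite G] {i : H →* G} (hi : Function.Injective i)
    (χ : H →* ℂ) (hst : ∀ g h, ∃ h', i h' = g * i h * g⁻¹ ∧ χ h' = χ h) :
    ∃ (V : Type v) (_ : AddCommGroup V) (_ : Module ℂ V) (η : Representation ℂ G V),
      η.IsIrreducible ∧ ∀ h v, η (i h) v = χ h • v := by
  have : Nontrivial (IndV i (oneDim χ)) := (indV_mk_one_injective hi (oneDim χ)).nontrivial
  obtain ⟨U, hU⟩ := exists_isIrreducible_toRepresentation (ind i (oneDim χ))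
  have := finiteDimensional_of_isIrreducible hU
  -- Coordinates in a finite basis move the representation to the prescribed universe.
  let e : U.toSubmodule ≃ₗ[ℂ] ULift.{v} (Fin (Module.finrank ℂ U.toSubmodule) → ℂ) :=
    (Module.finBasis ℂ U.toSubmodule).equivFun.trans ULift.moduleEquiv.symm
  refine ⟨_, inferInstance, inferInstance, transport U.toRepresentation e,
    isIrreducible_of_bijective hU e.toLinearMap e.bijective fun g v => ?_, fun h v => ?_⟩
  · rw [transport_apply]
    simp
  · rw [transport_apply]
    have h1 : U.toRepresentation (i h) (e.symm v) = χ h • e.symm v :=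
      Subtype.ext (ind_oneDim_apply i χ hst h _)
    rw [h1, map_smul, LinearEquiv.apply_symm_apply]

end Induction

/-! ### The projector onto an isotypic part -/

section Projector

variable {G V : Type*} [Group G] [AddCommGroup V] [Module ℂ V] {K : Subgroup G}

/-- The projector onto the `φ`-isotypic part of `π`. -/
def projector [Finite K] (π : Representation ℂ G V) (φ : K →* ℂ) : V →ₗ[ℂ] V :=
  letI := Fintype.ofFinite K
  (Nat.card K : ℂ)⁻¹ • ∑ k : K, φ k⁻¹ • π k

theorem projector_apply [Fintype K] (π : Representation ℂ G V) (φ : K →* ℂ) (v : V) :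
    projector π φ v = (Nat.card K : ℂ)⁻¹ • ∑ k : K, φ k⁻¹ • π k v := by
  simp only [projector, LinearMap.smul_apply, LinearMap.sum_apply]
  congr!

theorem projector_of_mem [Finite K] (π : Representation ℂ G V) (φ : K →* ℂ) {v : V}
    (hv : v ∈ eigenspace π ((↑) : K → G) φ) : projector π φ v = v := by
  have := Fintype.ofFinite K
  rw [projector_apply]
  have : ∀ k : K, φ k⁻¹ • π k v = v := fun k => by
    rw [hv k, smul_smul, ← map_mul, inv_mul_cancel, map_one, one_smul]
  simp only [this, Finset.sum_const, Finset.card_univ]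
  rw [← Nat.cast_smul_eq_nsmul ℂ, smul_smul, Nat.card_eq_fintype_card, inv_mul_cancel₀, one_smul]
  exact Nat.cast_ne_zero.2 Fintype.card_ne_zero

theorem projector_mem [Finite K] (π : Representation ℂ G V) (φ : K →* ℂ) (v : V) :
    projector π φ v ∈ eigenspace π ((↑) : K → G) φ := by
  have := Fintype.ofFinite K
  intro k
  rw [projector_apply, map_smul, smul_comm (φ k), map_sum]
  congr 1
  rw [Finset.smul_sum, ← Equiv.sum_comp (Equiv.mulLeft k) fun x : K => φ k • φ x⁻¹ • π x v]
  refine Finset.sum_congr rfl fun x _ => ?_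
  simp only [Equiv.coe_mulLeft, map_smul, mul_inv_rev, Subgroup.coe_mul, map_mul,
    Module.End.mul_apply]
  rw [smul_smul, mul_left_comm, ← map_mul, mul_inv_cancel, map_one, mul_one]

/-- The projection of `v` is a multiple of `v`, hence an eigenvector for both `c` and `φ`; these
differ at `k`. -/
theorem projector_of_ne [Finite K] (π : Representation ℂ G V) (c : K → ℂ) (φ : K →* ℂ) {v : V}
    (hv : v ∈ eigenspace π ((↑) : K → G) c) {k : K} (hk : c k ≠ φ k) : projector π φ v = 0 := by
  have := Fintype.ofFinite K
  have h1 : ∃ a : ℂ, projector π φ v = a • v := by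
    refine ⟨(Nat.card K : ℂ)⁻¹ * ∑ k : K, φ k⁻¹ * c k, ?_⟩
    rw [projector_apply, ← smul_smul, Finset.sum_smul]
    simp only [hv _, smul_smul]
  obtain ⟨a, ha⟩ := h1
  have h2 := projector_mem π φ v k
  rw [ha, map_smul, hv k, smul_smul, smul_smul, mul_comm, ← sub_eq_zero, ← sub_smul,
    ← sub_mul, mul_smul] at h2
  rw [ha]
  exact (smul_eq_zero.1 h2).resolve_left (sub_ne_zero.2 hk)

end Projector

/-! ### Clifford theory over a character of a normal subgroup -/

section Clifford

open Representation

variable {G V W : Type*} [Group G] [AddCommGroup V] [Module ℂ V]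
  [AddCommGroup W] [Module ℂ W] {K : Subgroup G} [K.Normal] {φ : K →* ℂ}

theorem exists_ne_of_not_mem_stabilizer {g : G} (hg : g ∉ stabilizer (oneDim φ)) :
    ∃ k : K, φ ⟨g * k * g⁻¹, ‹K.Normal›.conj_mem k k.2 g⟩ ≠ φ k := by
  by_contra! h
  refine hg (mem_stabilizer_oneDim.2 ⟨fun x => ⟨fun hx => ‹K.Normal›.conj_mem x hx g,
    fun hx => ?_⟩, ?_⟩)
  · simpa [mul_assoc] using ‹K.Normal›.conj_mem _ hx g⁻¹
  · rintro x ⟨_, hy⟩ rfl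
    exact (h x).symm

variable {T : Subgroup G} (hT : T = stabilizer (oneDim φ)) (hKT : K ≤ T)

omit [K.Normal] in
include hT in
theorem conj_mem_of_mem_stabilizer (t : T) (k : K) :
    ∃ k' : K, (k' : G) = t * k * t⁻¹ ∧ φ k' = φ k := by
  have ht := mem_stabilizer_oneDim.1 (hT.le t.2)
  exact ⟨⟨t * k * t⁻¹, (ht.1 k).1 k.2⟩, rfl, (ht.2 k _ rfl).symm⟩

/-- `K` acts on `θ` through the scalars `φ`. -/
def IsScalarOn {H : Subgroup G} (h : K ≤ H) (φ : K →* ℂ) (θ : Representation ℂ H V) : Prop :=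
  ∀ k v, θ (Subgroup.inclusion h k) v = φ k • v

theorem ind_mk_mem_eigenspace {θ : Representation ℂ T V} (hθ : IsScalarOn hKT φ θ) (g : G) (v : V) :
    IndV.mk T.subtype θ g v ∈ eigenspace (ind T.subtype θ) ((↑) : K → G)
      fun k => φ ⟨g * k * g⁻¹, ‹K.Normal›.conj_mem k k.2 g⟩ := by
  intro k
  set k' : K := ⟨g * k * g⁻¹, ‹K.Normal›.conj_mem k k.2 g⟩
  have h1 : g * (k : G)⁻¹ = T.subtype (Subgroup.inclusion hKT k'⁻¹) * g := by
    simp [k', mul_assoc]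
  rw [ind_mk, h1, indV_mk_apply_mul, ← map_inv, inv_inv, hθ, map_smul]

theorem ind_mk_one_mem_eigenspace {θ : Representation ℂ T V} (hθ : IsScalarOn hKT φ θ) (v : V) :
    IndV.mk T.subtype θ 1 v ∈ eigenspace (ind T.subtype θ) ((↑) : K → G) φ := by
  intro k
  rw [ind_mk_mem_eigenspace hKT hθ 1 v k]
  simp

include hT in
-- On the block of `g` the group `K` acts through the conjugate of `φ` by `g`, which differs from
-- `φ` unless `g ∈ T`. So the `φ`-isotypic part of the induced representation is just the copy of
-- `θ` at `g = 1`.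
theorem projector_ind_mem_range [Finite G] {θ : Representation ℂ T V} (hθ : IsScalarOn hKT φ θ)
    (u : IndV T.subtype θ) :
    projector (ind T.subtype θ) φ u ∈ LinearMap.range (IndV.mk T.subtype θ 1) := by
  have : (LinearMap.range (IndV.mk T.subtype θ 1)).comap (projector (ind T.subtype θ) φ) = ⊤ := by
    refine indV_induction _ fun g v => ?_
    rw [Submodule.mem_comap]
    by_cases hg : g ∈ T
    · have h1 := indV_mk_apply_mul T.subtype θ ⟨g, hg⟩ 1 v
      rw [mul_one] at h1
      change IndV.mk T.subtype θ g v = _ at h1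
      rw [h1, projector_of_mem _ _ (ind_mk_one_mem_eigenspace hKT hθ _)]
      exact ⟨_, rfl⟩
    · obtain ⟨k, hk⟩ := exists_ne_of_not_mem_stabilizer (hT ▸ hg)
      rw [projector_of_ne _ _ φ (ind_mk_mem_eigenspace hKT hθ g v) hk]
      exact zero_mem _
  exact (this ▸ Submodule.mem_top : u ∈ Submodule.comap _ _)

include hT in
theorem mem_range_of_mem_eigenspace [Finite G] {θ : Representation ℂ T V} (hθ : IsScalarOn hKT φ θ)
    {u : IndV T.subtype θ} (hu : u ∈ eigenspace (ind T.subtype θ) ((↑) : K → G) φ) :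
    u ∈ LinearMap.range (IndV.mk T.subtype θ 1) := by
  rw [← projector_of_mem _ _ hu]
  exact projector_ind_mem_range hT hKT hθ u

include hT in
-- An invariant subspace contains the copy of `θ`, and is then everything, or meets it in `0`, and
-- is then killed by the projector. Two complementary subspaces cannot both be killed, since the
-- projector fixes the copy of `θ`.
theorem ind_isIrreducible [Finite G] {θ : Representation ℂ T V} (hirr : θ.IsIrreducible)
    (hθ : IsScalarOn hKT φ θ) : (ind T.subtype θ).IsIrreducible := by
  have := nontrivial_of_isIrreducible hirr
  have : Nontrivial (IndV T.subtype θ) :=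
    (indV_mk_one_injective T.subtype_injective θ).nontrivial
  have key : ∀ U : Submodule ℂ (IndV T.subtype θ), (∀ g, ∀ v ∈ U, ind T.subtype θ g v ∈ U) →
      U.comap (IndV.mk T.subtype θ 1) = ⊥ ∨ U = ⊤ := by
    intro U hU
    refine (eq_bot_or_eq_top_of_isIrreducible hirr _ fun t v hv => ?_).imp_right fun h => ?_
    · rw [Submodule.mem_comap, ← ind_mk_one_apply]
      exact hU _ _ hv
    · refine indV_induction _ fun g v => ?_
      have h1 : v ∈ U.comap (IndV.mk T.subtype θ 1) := h ▸ Submodule.mem_top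
      have h2 := hU g⁻¹ _ h1
      rwa [ind_mk, one_mul, inv_inv] at h2
  refine isIrreducible_of_forall fun U hU => ?_
  refine (key U hU).imp_left fun h => ?_
  -- Maschke's theorem.
  obtain ⟨U', hU'⟩ := exists_isCompl
    (⟨U, fun g v hv => hU g v hv⟩ : Subrepresentation (ind T.subtype θ))
  have hsup : U ⊔ U'.toSubmodule = ⊤ :=
    congrArg Subrepresentation.toSubmodule hU'.sup_eq_top
  have hinf : U ⊓ U'.toSubmodule = ⊥ :=
    congrArg Subrepresentation.toSubmodule hU'.inf_eq_bot
  have htop : U'.toSubmodule = ⊤ := by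
    refine (key U'.toSubmodule fun g v hv => U'.apply_mem_toSubmodule g hv).resolve_left
      fun h' => ?_
    obtain ⟨v, hv⟩ := exists_ne (0 : V)
    have hproj : ∀ X : Submodule ℂ (IndV T.subtype θ), (∀ g, ∀ v ∈ X, ind T.subtype θ g v ∈ X) →
        X.comap (IndV.mk T.subtype θ 1) = ⊥ → ∀ x ∈ X, projector (ind T.subtype θ) φ x = 0 := by
      intro X hX hX0 x hx
      have := Fintype.ofFinite K
      obtain ⟨v, hv⟩ := projector_ind_mem_range hT hKT hθ x
      have h1 : projector (ind T.subtype θ) φ x ∈ X := by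
        rw [projector_apply]
        exact X.smul_mem _ (X.sum_mem fun k _ => X.smul_mem _ (hX _ _ hx))
      have h2 : v ∈ X.comap (IndV.mk T.subtype θ 1) := by
        rw [Submodule.mem_comap, hv]
        exact h1
      rw [hX0, Submodule.mem_bot] at h2
      rw [← hv, h2, map_zero]
    obtain ⟨x, hx, y, hy, hxy⟩ := Submodule.mem_sup.1
      (hsup ▸ Submodule.mem_top : IndV.mk T.subtype θ 1 v ∈ U ⊔ U'.toSubmodule)
    have h3 := projector_of_mem _ _ (ind_mk_one_mem_eigenspace hKT hθ v)
    rw [← hxy, map_add, hproj U hU h x hx,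
      hproj _ (fun g v hv => U'.apply_mem_toSubmodule g hv) h' y hy, add_zero, hxy] at h3
    exact hv (indV_mk_one_injective T.subtype_injective θ (h3.symm.trans (map_zero _).symm))
  rwa [htop, inf_top_eq] at hinf

theorem ind_contains {θ : Representation ℂ T V} (hirr : θ.IsIrreducible)
    (hθ : IsScalarOn hKT φ θ) : Contains ((ind T.subtype θ).comp K.subtype) (oneDim φ) := by
  have := nontrivial_of_isIrreducible hirr
  obtain ⟨v, hv⟩ := exists_ne (0 : V)
  refine contains_oneDim_iff.2 ⟨IndV.mk T.subtype θ 1 v, fun h => hv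
    (indV_mk_one_injective T.subtype_injective θ (h.trans (map_zero _).symm)), fun k => ?_⟩
  exact ind_mk_one_mem_eigenspace hKT hθ v k

include hT in
-- `θ` is recovered from the induced representation as its `φ`-isotypic part, which every
-- equivalence preserves.
theorem equiv_of_ind_equiv [Finite G] {θ : Representation ℂ T V} {θ' : Representation ℂ T W}
    (hirr : θ.IsIrreducible) (hirr' : θ'.IsIrreducible)
    (hθ : IsScalarOn hKT φ θ) (hθ' : IsScalarOn hKT φ θ')
    (e : Representation.Equiv (ind T.subtype θ) (ind T.subtype θ')) :
    Nonempty (Representation.Equiv θ θ') := by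
  have hmem : ∀ v, e (IndV.mk T.subtype θ 1 v) ∈ LinearMap.range (IndV.mk T.subtype θ' 1) := by
    intro v
    refine mem_range_of_mem_eigenspace hT hKT hθ' fun k => ?_
    have h1 := IntertwiningMap.isIntertwining _ _ e.toIntertwiningMap (k : G)
      (IndV.mk T.subtype θ 1 v)
    change e _ = ind T.subtype θ' k (e _) at h1
    rw [← h1, ind_mk_one_mem_eigenspace hKT hθ v k, map_smul]
  have hinj := indV_mk_one_injective T.subtype_injective θ'
  let m := LinearEquiv.ofInjective (IndV.mk T.subtype θ' 1) hinj
  let f : V →ₗ[ℂ] W := m.symm.toLinearMap ∘ₗ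
    ((e.toLinearEquiv.toLinearMap ∘ₗ IndV.mk T.subtype θ 1).codRestrict _ hmem)
  have hf : ∀ v, IndV.mk T.subtype θ' 1 (f v) = e (IndV.mk T.subtype θ 1 v) := fun v =>
    congrArg Subtype.val (m.apply_symm_apply ⟨_, hmem v⟩)
  let F : IntertwiningMap θ θ' := ⟨f, fun t => LinearMap.ext fun v => hinj <| by
    change IndV.mk T.subtype θ' 1 (f (θ t v)) = IndV.mk T.subtype θ' 1 (θ' t (f v))
    rw [hf, ← ind_mk_one_apply, ← ind_mk_one_apply, hf]
    exact IntertwiningMap.isIntertwining _ _ e.toIntertwiningMap _ _⟩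
  refine ⟨F.ofBijective ((IsIrreducible.bijective_or_eq_zero F).resolve_right fun h => ?_)⟩
  have := nontrivial_of_isIrreducible hirr
  obtain ⟨v, hv⟩ := exists_ne (0 : V)
  have h1 : f v = 0 := congrArg (fun g : IntertwiningMap θ θ' => g v) h
  have h2 := hf v
  rw [h1, map_zero] at h2
  refine hv (indV_mk_one_injective T.subtype_injective θ ?_)
  rw [map_zero]
  exact e.toLinearEquiv.map_eq_zero_iff.1 h2.symm

include hT in
-- The `φ`-isotypic part of `π` is stable under `T`. An irreducible `θ` inside it gives, by
-- Frobenius reciprocity, a nonzero map between irreducible representations.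
theorem exists_equiv_ind.{v} [Finite G] {W : Type v} [AddCommGroup W] [Module ℂ W]
    {π : Representation ℂ G W}
    (hπ : π.IsIrreducible) (hc : Contains (π.comp K.subtype) (oneDim φ)) :
    ∃ (V : Type v) (_ : AddCommGroup V) (_ : Module ℂ V) (θ : Representation ℂ T V),
      θ.IsIrreducible ∧ IsScalarOn hKT φ θ ∧
        Nonempty (Representation.Equiv π (ind T.subtype θ)) := by
  obtain ⟨v, hv0, hv⟩ := contains_oneDim_iff.1 hc
  let M : Subrepresentation (A := ℂ) (ρ := π.comp T.subtype) :=
    ⟨eigenspace π ((↑) : K → G) φ, fun t v hv => apply_mem_eigenspace (fun k => by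
      obtain ⟨k', hk, hφ⟩ := conj_mem_of_mem_stabilizer hT t⁻¹ k
      exact ⟨k', by rw [hk]; simp [mul_assoc], hφ⟩) hv⟩
  have : Nontrivial M.toSubmodule := ⟨⟨v, hv⟩, 0, fun h => hv0 (congrArg Subtype.val h)⟩
  obtain ⟨U, hU⟩ := exists_isIrreducible_toRepresentation M.toRepresentation
  have hUs : IsScalarOn hKT φ U.toRepresentation := fun k u =>
    Subtype.ext (Subtype.ext (u.1.2 k))
  have hirr := ind_isIrreducible hT hKT hU hUs
  refine ⟨_, _, _, U.toRepresentation, hU, hUs, ?_⟩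
  let F := indHom T.subtype U.toRepresentation π
    (M.toSubmodule.subtype ∘ₗ U.toSubmodule.subtype) fun t v => rfl
  refine ⟨(F.ofBijective ((IsIrreducible.bijective_or_eq_zero F).resolve_right fun h => ?_)).symm⟩
  have := nontrivial_of_isIrreducible hU
  obtain ⟨u, hu⟩ := exists_ne (0 : U.toSubmodule)
  have h1 := indHom_mk_one T.subtype U.toRepresentation π
    (M.toSubmodule.subtype ∘ₗ U.toSubmodule.subtype) (fun t v => rfl) u
  change F _ = _ at h1
  rw [h] at h1
  exact hu (Subtype.ext (Subtype.ext h1.symm))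

end Clifford

/-! ### Centralizers and the trace pairing for two by two matrices -/

section Matrices

variable {A : Type*} [CommRing A]

/-- Matrices commuting with `b` modulo `c` lie in `A[b]` modulo `c`. -/
theorem exists_eq_add_of_commutator {b X Y : Matrix (Fin 2) (Fin 2) A} {c : A}
    (hb : IsUnit (b 1 0)) (h : b * X - X * b = c • Y) :
    ∃ (s t : A) (Z : Matrix (Fin 2) (Fin 2) A), X = s • 1 + t • b + c • Z := by
  obtain ⟨u, hu⟩ := hb
  have hv : (↑u⁻¹ : A) * b 1 0 = 1 := by rw [← hu, Units.inv_mul]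
  generalize (↑u⁻¹ : A) = v at hv
  have h00 := congrFun (congrFun h 0) 0
  have h10 := congrFun (congrFun h 1) 0
  simp only [Matrix.sub_apply, Matrix.mul_apply, Fin.sum_univ_two, Matrix.smul_apply,
    smul_eq_mul] at h00 h10
  -- As `b 1 0` is a unit, `s` and `t` can be chosen so that `s • 1 + t • b` has the same first
  -- column as `X`; the commutator relation then forces the second columns to agree modulo `c`.
  refine ⟨X 0 0 - v * X 1 0 * b 0 0, v * X 1 0, !![0, -(v * Y 0 0); 0, -(v * Y 1 0)], ?_⟩
  ext i j
  fin_cases i <;> fin_cases j <;> simp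
  · linear_combination (-v) * h00 + (b 0 1 * X 1 0 * 0 - X 0 1) * hv
  · linear_combination (- X 1 0) * hv
  · linear_combination (-v) * h10 + (X 0 0 - X 1 1) * hv

theorem sq_eq (b : Matrix (Fin 2) (Fin 2) A) : b * b = b.trace • b - b.det • 1 := by
  ext i j
  fin_cases i <;> fin_cases j <;>
    simp [Matrix.mul_apply, Fin.sum_univ_two, Matrix.trace, Matrix.det_fin_two] <;> ring

theorem mem_adjoin_iff {b X : Matrix (Fin 2) (Fin 2) A} :
    X ∈ Algebra.adjoin A {b} ↔ ∃ s t : A, X = s • 1 + t • b := by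
  constructor
  · intro h
    induction h using Algebra.adjoin_induction with
    | mem x hx =>
      obtain rfl := hx
      exact ⟨0, 1, by simp⟩
    | algebraMap a => exact ⟨a, 0, by simp [Algebra.algebraMap_eq_smul_one]⟩
    | add x y _ _ hx hy =>
      obtain ⟨s, t, rfl⟩ := hx
      obtain ⟨s', t', rfl⟩ := hy
      exact ⟨s + s', t + t', by module⟩
    | mul x y _ _ hx hy =>
      obtain ⟨s, t, rfl⟩ := hx
      obtain ⟨s', t', rfl⟩ := hy
      refine ⟨s * s' - t * t' * b.det, s * t' + t * s' + t * t' * b.trace, ?_⟩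
      simp only [add_mul, mul_add, smul_mul_smul_comm, mul_one, one_mul, sq_eq]
      module
  · rintro ⟨s, t, rfl⟩
    exact add_mem (Subalgebra.smul_mem _ (one_mem _) _)
      (Subalgebra.smul_mem _ (Algebra.self_mem_adjoin_singleton _ _) _)

/-- Multiples of elementary matrices isolate the entries of `D`, which reduces the claim to
primitivity of `ψ`. -/
theorem eq_zero_of_trace {ψ : AddChar A ℂ} (hψ : ∀ a : A, (∀ y, ψ (a * y) = 1) → a = 0)
    {D : Matrix (Fin 2) (Fin 2) A} (hD : ∀ Y : Matrix (Fin 2) (Fin 2) A, ψ (D * Y).trace = 1) :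
    D = 0 := by
  ext i j
  refine hψ _ fun y => ?_
  have h := hD (Matrix.single j i y)
  rwa [Matrix.trace_mul_single] at h

theorem addChar_sub_eq_one {ψ : AddChar A ℂ} {x y : A} (h : ψ x = ψ y) : ψ (x - y) = 1 := by
  have h1 := AddChar.map_add_eq_mul ψ (x - y) y
  rw [sub_add_cancel, h] at h1
  have h2 : ψ y ≠ 0 := by
    intro h0
    have h3 := AddChar.map_add_eq_mul ψ y (-y)
    rw [h0, add_neg_cancel, AddChar.map_zero_eq_one, zero_mul] at h3
    exact one_ne_zero h3
  exact (mul_right_cancel₀ h2 ((one_mul _).trans h1)).symm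

end Matrices

/-! ### Congruence subgroups and the units of `O_r[b]` -/

section Congruence

variable {O : Type*} [CommRing O] [IsLocalRing O] {r : ℕ}

/-- The element `ϖ` of `O / 𝔭 ^ r` is the image of a uniformizer. -/
def IsUniformizer (ϖ : OMod O r) : Prop :=
  ∀ i, (maximalIdeal O ^ i).map (toOMod O r) = Ideal.span {ϖ ^ i}

variable {ϖ : OMod O r} {b : Matrix (Fin 2) (Fin 2) (OMod O r)}

theorem IsUniformizer.pow_eq_zero (hϖ : IsUniformizer ϖ) {n : ℕ} (hn : r ≤ n) : ϖ ^ n = 0 := by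
  have h : ϖ ^ r = 0 := by
    have h1 := hϖ r
    rw [Ideal.map_quotient_self] at h1
    exact (Ideal.span_singleton_eq_bot.1 h1.symm)
  rw [← Nat.add_sub_of_le hn, pow_add, h, zero_mul]

instance K_normal (i : ℕ) : (K O r i).Normal := inferInstanceAs (MonoidHom.ker _).Normal

theorem mem_K_iff (hϖ : IsUniformizer ϖ) {i : ℕ} {x : Gr O r} :
    x ∈ K O r i ↔ ∃ Y, x.val = 1 + ϖ ^ i • Y := by
  have key : x ∈ K O r i ↔
      ∀ a c, ϖ ^ i ∣ x.val a c - (1 : Matrix (Fin 2) (Fin 2) (OMod O r)) a c := by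
    rw [K, MonoidHom.mem_ker, Units.ext_iff, ← Matrix.ext_iff]
    refine forall₂_congr fun a c => ?_
    rw [← Ideal.mem_span_singleton, ← hϖ, ← Ideal.Quotient.mk_eq_mk_iff_sub_mem]
    refine Eq.congr rfl ?_
    rw [Units.val_one, Matrix.one_apply, Matrix.one_apply]
    split_ifs <;> simp
  rw [key]
  constructor
  · intro h
    choose Y hY using h
    refine ⟨Matrix.of Y, ?_⟩
    ext a c
    rw [Matrix.add_apply, Matrix.smul_apply, smul_eq_mul, Matrix.of_apply, ← hY]
    ring
  · rintro ⟨Y, hY⟩ a c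
    rw [hY, Matrix.add_apply, add_sub_cancel_left]
    exact ⟨_, rfl⟩

theorem exists_mem_K (hϖ : IsUniformizer ϖ) {i : ℕ} (hi : 1 ≤ i)
    (Y : Matrix (Fin 2) (Fin 2) (OMod O r)) : ∃ x ∈ K O r i, x.val = 1 + ϖ ^ i • Y := by
  have h : IsNilpotent (ϖ ^ i • Y) := by
    refine ⟨r, ?_⟩
    rw [smul_pow, ← pow_mul, hϖ.pow_eq_zero (Nat.le_mul_of_pos_left r hi), zero_smul]
  obtain ⟨x, hx⟩ := h.isUnit_one_add
  exact ⟨x, (mem_K_iff hϖ).2 ⟨Y, hx⟩, hx⟩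

/-- Only closure under inverses is at issue: by Cayley–Hamilton `x⁻¹` is `det x⁻¹ • (tr x • 1 - x)`,
again a polynomial in `b`. -/
theorem mem_unitsAdjoin_iff {x : Gr O r} :
    x ∈ unitsAdjoin b ↔ ∃ s t : OMod O r, x.val = s • 1 + t • b := by
  rw [← mem_adjoin_iff, unitsAdjoin, Submonoid.mem_units_iff]
  refine ⟨fun h => h.1, fun h => ⟨h, ?_⟩⟩
  change (x⁻¹).val ∈ Algebra.adjoin _ _
  obtain ⟨u, hu⟩ : IsUnit x.val.det := (Matrix.isUnit_iff_isUnit_det _).1 x.isUnit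
  have h1 : (x⁻¹).val = (↑u⁻¹ : OMod O r) • (x.val.trace • 1 - x.val) := by
    have h3 : x.val * ((↑u⁻¹ : OMod O r) • (x.val.trace • 1 - x.val)) = 1 := by
      rw [Matrix.mul_smul, mul_sub, sq_eq x.val, Matrix.mul_smul, mul_one, sub_sub_cancel,
        smul_smul, ← hu, Units.inv_mul, one_smul]
    exact Units.inv_eq_of_mul_eq_one_right h3
  rw [h1]
  exact Subalgebra.smul_mem _ (sub_mem (Subalgebra.smul_mem _ (one_mem _) _) h) _

theorem mul_comm_of_mem_unitsAdjoin {x y : Gr O r} (hx : x ∈ unitsAdjoin b)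
    (hy : y ∈ unitsAdjoin b) : x * y = y * x := by
  obtain ⟨s, t, hx⟩ := mem_unitsAdjoin_iff.1 hx
  obtain ⟨s', t', hy⟩ := mem_unitsAdjoin_iff.1 hy
  refine Units.ext ?_
  simp only [Units.val_mul, hx, hy, add_mul, mul_add, smul_mul_smul_comm, mul_one, one_mul]
  module

theorem mul_comm_val_of_mem_unitsAdjoin {x : Gr O r} (hx : x ∈ unitsAdjoin b) :
    b * x.val = x.val * b := by
  obtain ⟨s, t, hx⟩ := mem_unitsAdjoin_iff.1 hx
  simp [hx, mul_add, add_mul]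

theorem commutator_val (x y : Gr O r) :
    (⁅x, y⁆ : Gr O r).val = 1 + (x.val * y.val - y.val * x.val) * x⁻¹.val * y⁻¹.val := by
  have h : y.val * x.val * x⁻¹.val * y⁻¹.val = 1 := by
    simp only [← Units.val_mul]
    rw [mul_inv_cancel_right, mul_inv_cancel, Units.val_one]
  rw [sub_mul, sub_mul, h, commutatorElement_def]
  simp only [Units.val_mul]
  abel

theorem commutator_mem_K (hϖ : IsUniformizer ϖ) {i j : ℕ} {x y : Gr O r} (hx : x ∈ K O r i)
    (hy : y ∈ K O r j) : ⁅x, y⁆ ∈ K O r (i + j) := by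
  obtain ⟨X, hX⟩ := (mem_K_iff hϖ).1 hx
  obtain ⟨Y, hY⟩ := (mem_K_iff hϖ).1 hy
  refine (mem_K_iff hϖ).2 ⟨(X * Y - Y * X) * x⁻¹.val * y⁻¹.val, ?_⟩
  rw [commutator_val, ← Matrix.smul_mul, ← Matrix.smul_mul, hX, hY]
  congr 3
  simp only [mul_add, add_mul, mul_one, one_mul, smul_mul_smul_comm, ← pow_add, add_comm j i,
    smul_sub]
  abel

theorem mem_Z1K_iff {i : ℕ} {x : Gr O r} :
    x ∈ Z1K b i ↔ ∃ z ∈ Z1 b, ∃ k ∈ K O r i, x = z * k := by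
  rw [← SetLike.mem_coe, Z1K, Subgroup.mul_normal, Set.mem_mul]
  simp only [SetLike.mem_coe, eq_comm]

/-- To first order `(1 + ϖ ^ i X) ^ n` is `1 + n ϖ ^ i X`, with an error divisible by `ϖ ^ (i + 1)`
because `2 i ≥ i + 1`. -/
theorem pow_mem_K (hϖ : IsUniformizer ϖ) {p i : ℕ} (hi : 1 ≤ i) (hp : ϖ ∣ (p : OMod O r))
    {x : Gr O r} (hx : x ∈ K O r i) : x ^ p ∈ K O r (i + 1) := by
  obtain ⟨X, hX⟩ := (mem_K_iff hϖ).1 hx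
  have h : ∀ n : ℕ, ∃ Z, (x ^ n).val = 1 + (n * ϖ ^ i) • X + ϖ ^ (i + 1) • Z := by
    intro n
    induction n with
    | zero => exact ⟨0, by simp⟩
    | succ n ih =>
      obtain ⟨Z, hZ⟩ := ih
      obtain ⟨j, rfl⟩ := Nat.exists_eq_add_of_le hi
      refine ⟨Z + Z * (ϖ ^ (1 + j) • X) + (n * ϖ ^ j) • (X * X), ?_⟩
      rw [pow_succ, Units.val_mul, hZ, hX]
      simp only [mul_add, add_mul, mul_one, one_mul, smul_mul_smul_comm, Matrix.mul_smul]
      push_cast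
      module
  obtain ⟨Z, hZ⟩ := h p
  obtain ⟨q, hq⟩ := hp
  refine (mem_K_iff hϖ).2 ⟨q • X + Z, ?_⟩
  rw [hZ, hq]
  module

end Congruence

/-! ### The stabilizer `T`, its action on `χ`, and the commutator form -/

section Stabilizer

variable {O : Type*} [CommRing O] [IsLocalRing O] {r l l' : ℕ} {ϖ : OMod O r}
  (hϖ : IsUniformizer ϖ) (hl' : 1 ≤ l') (hl : l = l' + 1) (hr : r = l + l')
  (hann : ∀ i ≤ r, ∀ a : OMod O r, ϖ ^ i * a = 0 → ϖ ^ (r - i) ∣ a)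
  {b : Matrix (Fin 2) (Fin 2) (OMod O r)} (hb : IsUnit (b 1 0))
  {ψ : AddChar (OMod O r) ℂ} (hψ : ∀ a : OMod O r, (∀ y, ψ (a * y) = 1) → a = 0)
  {φ : K O r l →* ℂ} (hφ : ∀ x : K O r l, φ x = ψ (b * (x.val.val - 1)).trace)

include hann in
theorem exists_eq_smul_of_smul_eq_zero {i : ℕ} (hi : i ≤ r)
    {D : Matrix (Fin 2) (Fin 2) (OMod O r)} (hD : ϖ ^ i • D = 0) :
    ∃ W : Matrix (Fin 2) (Fin 2) (OMod O r), D = ϖ ^ (r - i) • W := by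
  have h : ∀ a c, ϖ ^ (r - i) ∣ D a c := fun a c => hann i hi _ (congrFun (congrFun hD a) c)
  choose W hW using h
  exact ⟨Matrix.of W, Matrix.ext hW⟩

theorem unitsAdjoin_conj_eq {g : Gr O r} {Y : Matrix (Fin 2) (Fin 2) (OMod O r)} {c : OMod O r}
    (h : b * g.val - g.val * b = c • Y) : g⁻¹.val * b * g.val = b + c • (g⁻¹.val * Y) := by
  rw [← Matrix.mul_smul, ← h, mul_sub, ← mul_assoc, ← mul_assoc, Units.inv_mul, one_mul,
    add_sub_cancel]

theorem trace_conj (g : Gr O r) (X : Matrix (Fin 2) (Fin 2) (OMod O r)) :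
    (b * (g.val * X * g⁻¹.val)).trace = (g⁻¹.val * b * g.val * X).trace := by
  rw [← mul_assoc, Matrix.trace_mul_comm]
  simp only [mul_assoc]

theorem conj_val_sub_one (g x : Gr O r) :
    (g * x * g⁻¹).val - 1 = g.val * (x.val - 1) * g⁻¹.val := by
  rw [mul_sub, sub_mul, mul_one, Units.mul_inv]
  rfl

include hϖ hl' hl hr hann hψ hφ in
-- Invariance says that `ϖ ^ l • (g⁻¹ b g - b)` pairs trivially with every matrix, hence is zero.
-- Dividing by `ϖ ^ l` leaves a congruence modulo `ϖ ^ (r - l) = ϖ ^ l'`.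
theorem mem_stabilizer_iff {g : Gr O r} :
    g ∈ stabilizer (oneDim φ) ↔ ∃ Y, b * g.val - g.val * b = ϖ ^ l' • Y := by
  constructor
  · intro hg
    have h1 : ϖ ^ l • (g⁻¹.val * b * g.val - b) = 0 := by
      refine eq_zero_of_trace hψ fun Y => ?_
      obtain ⟨x, hx, hxY⟩ := exists_mem_K hϖ (i := l) (by omega) Y
      have h2 := (mem_stabilizer_oneDim.1 hg).2 ⟨x, hx⟩ ⟨_, (K_normal l).conj_mem x hx g⟩ rfl
      rw [hφ, hφ] at h2
      have h3 := addChar_sub_eq_one h2.symm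
      simp only [conj_val_sub_one, trace_conj] at h3
      rw [← Matrix.trace_sub, ← sub_mul, hxY, add_sub_cancel_left, Matrix.mul_smul,
        ← Matrix.smul_mul] at h3
      exact h3
    obtain ⟨W, hW⟩ := exists_eq_smul_of_smul_eq_zero hann (by omega) h1
    rw [show r - l = l' by omega] at hW
    refine ⟨g.val * W, ?_⟩
    rw [← Matrix.mul_smul, ← hW, mul_sub, ← mul_assoc, ← mul_assoc, Units.mul_inv, one_mul]
  · rintro ⟨Y, hY⟩
    refine mem_stabilizer_oneDim.2 ⟨fun x => ⟨fun hx => (K_normal l).conj_mem x hx g, fun hx => ?_⟩,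
      ?_⟩
    · simpa [mul_assoc] using (K_normal l).conj_mem _ hx g⁻¹
    · rintro ⟨x, hx⟩ ⟨_, hy⟩ rfl
      obtain ⟨X, hX⟩ := (mem_K_iff hϖ).1 hx
      rw [hφ, hφ]
      simp only [conj_val_sub_one, trace_conj]
      rw [unitsAdjoin_conj_eq hY, add_mul, hX, add_sub_cancel_left, smul_mul_smul_comm, ← pow_add,
        hϖ.pow_eq_zero (show r ≤ l' + l by omega), zero_smul, add_zero]

include hϖ hl' hl hr hann hψ hφ in
theorem unitsAdjoin_le_stabilizer : unitsAdjoin b ≤ stabilizer (oneDim φ) := by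
  intro g hg
  refine (mem_stabilizer_iff hϖ hl' hl hr hann hψ hφ).2 ⟨0, ?_⟩
  rw [mul_comm_val_of_mem_unitsAdjoin hg, sub_self, smul_zero]

include hϖ hl' hl hr hann hψ hφ in
theorem K_le_stabilizer : K O r l' ≤ stabilizer (oneDim φ) := by
  intro g hg
  obtain ⟨X, hX⟩ := (mem_K_iff hϖ).1 hg
  refine (mem_stabilizer_iff hϖ hl' hl hr hann hψ hφ).2 ⟨b * X - X * b, ?_⟩
  rw [hX]
  simp only [mul_add, add_mul, mul_one, one_mul, Matrix.mul_smul, Matrix.smul_mul, smul_sub]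
  abel

include hϖ hl' hl hr hann hψ hφ in
theorem Z1K_le_stabilizer {i : ℕ} (hi : l' ≤ i) : Z1K b i ≤ stabilizer (oneDim φ) :=
  sup_le (inf_le_left.trans (unitsAdjoin_le_stabilizer hϖ hl' hl hr hann hψ hφ))
    ((K_anti hi).trans (K_le_stabilizer hϖ hl' hl hr hann hψ hφ))

include hϖ hl' hl hr hann hψ hφ hb in
theorem exists_eq_mul_of_mem_stabilizer {g : Gr O r} (hg : g ∈ stabilizer (oneDim φ)) :
    ∃ c ∈ unitsAdjoin b, ∃ k ∈ K O r l', g = c * k := by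
  obtain ⟨Y, hY⟩ := (mem_stabilizer_iff hϖ hl' hl hr hann hψ hφ).1 hg
  obtain ⟨s, t, Z, hZ⟩ := exists_eq_add_of_commutator hb hY
  -- Chosen so that `g * k = g - ϖ ^ l' Z`, which is exactly `s • 1 + t • b`.
  obtain ⟨k, hk, hkv⟩ := exists_mem_K hϖ hl' (-(g⁻¹.val * Z))
  refine ⟨g * k, mem_unitsAdjoin_iff.2 ⟨s, t, ?_⟩, k⁻¹, inv_mem hk, by group⟩
  rw [Units.val_mul, hkv, mul_add, mul_one, smul_neg, mul_neg, Matrix.mul_smul, ← mul_assoc,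
    Units.mul_inv, one_mul]
  conv_lhs => enter [1]; rw [hZ]
  abel

theorem Z1_le_Z1K (b : Matrix (Fin 2) (Fin 2) (OMod O r)) (i : ℕ) : Z1 b ≤ Z1K b i :=
  le_sup_left

include hϖ hl in
theorem commutator_mem_K_of_mem_Z1 {g z : Gr O r} (hg : g ∈ K O r l') (hz : z ∈ Z1 b) :
    ⁅g, z⁆ ∈ K O r l := hl ▸ commutator_mem_K hϖ hg hz.2

include hϖ hl' hl hr hann hψ hφ hb in
-- Write `g = c k`. The factor `c` commutes with `Z¹`, and `k` moves `Z¹` only by commutators in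
-- `K_l ≤ K_i`.
theorem conj_mem_Z1K {i : ℕ} (hi : i ≤ l) {g x : Gr O r} (hg : g ∈ stabilizer (oneDim φ))
    (hx : x ∈ Z1K b i) : g * x * g⁻¹ ∈ Z1K b i := by
  obtain ⟨c, hc, k, hk, rfl⟩ := exists_eq_mul_of_mem_stabilizer hϖ hl' hl hr hann hb hψ hφ hg
  have h1 : ∀ x ∈ Z1K b i, k * x * k⁻¹ ∈ Z1K b i := by
    intro x hx
    obtain ⟨z, hz, y, hy, rfl⟩ := mem_Z1K_iff.1 hx
    have h : k * (z * y) * k⁻¹ = ⁅k, z⁆ * z * (k * y * k⁻¹) := by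
      rw [commutatorElement_def]; group
    rw [h]
    exact mul_mem (mul_mem (K_le_Z1K b i (K_anti hi (commutator_mem_K_of_mem_Z1 hϖ hl hk hz)))
      (Z1_le_Z1K b i hz)) (K_le_Z1K b i ((K_normal i).conj_mem y hy k))
  have h2 : ∀ x ∈ Z1K b i, c * x * c⁻¹ ∈ Z1K b i := by
    intro x hx
    obtain ⟨z, hz, y, hy, rfl⟩ := mem_Z1K_iff.1 hx
    have h : c * (z * y) * c⁻¹ = z * (c * y * c⁻¹) := by
      rw [← mul_assoc, mul_comm_of_mem_unitsAdjoin hc hz.1]; group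
    rw [h]
    exact mul_mem (Z1_le_Z1K b i hz) (K_le_Z1K b i ((K_normal i).conj_mem y hy c))
  have h3 := h2 _ (h1 x hx)
  simpa [mul_assoc] using h3

include hϖ hl' hl hr hann hψ hφ hb in
theorem normal_subgroupOf_stabilizer {i : ℕ} (hi : i ≤ l) {H : Subgroup (Gr O r)}
    (hH : H ≤ stabilizer (oneDim φ)) : ((Z1K b i).subgroupOf H).Normal :=
  ⟨fun _ hx g => conj_mem_Z1K hϖ hl' hl hr hann hb hψ hφ hi (hH g.2) hx⟩

/-- Elements of `Z¹ K_{l'}` are products of elements of `K_{l'}` and `Z¹`. -/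
theorem exists_eq_mul_of_mem_Z1K {i : ℕ} {x : Gr O r} (hx : x ∈ Z1K b i) :
    ∃ k ∈ K O r i, ∃ z ∈ Z1 b, x = k * z := by
  obtain ⟨z, hz, k, hk, rfl⟩ := mem_Z1K_iff.1 hx
  exact ⟨z * k * z⁻¹, (K_normal i).conj_mem k hk z, z, hz, by group⟩

include hϖ hl' hl hr hann hψ hφ hb in
-- Every class has a representative in `K_{l'}`, whose commutators lie in `K_{2 l'} ≤ K_l` and whose
-- `p`-th powers lie in `K_{l' + 1} = K_l`.
theorem isElementaryAbelianQuotient_Z1K {p : ℕ} (hp : ϖ ∣ (p : OMod O r)) :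
    IsElementaryAbelianQuotient p (Z1K b l) (Z1K b l') := by
  have hn := normal_subgroupOf_stabilizer hϖ hl' hl hr hann hb hψ hφ le_rfl
    (Z1K_le_stabilizer hϖ hl' hl hr hann hψ hφ le_rfl)
  refine ⟨hn, ?_, ?_⟩
  · have key : ∀ x : Z1K b l', ∃ k : Z1K b l', (k : Gr O r) ∈ K O r l' ∧
        (QuotientGroup.mk k : Z1K b l' ⧸ (Z1K b l).subgroupOf (Z1K b l')) = QuotientGroup.mk x := by
      rintro ⟨x, hx⟩
      obtain ⟨k, hk, z, hz, rfl⟩ := exists_eq_mul_of_mem_Z1K hx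
      refine ⟨⟨k, K_le_Z1K b l' hk⟩, hk, QuotientGroup.eq.2 ?_⟩
      rw [Subgroup.mem_subgroupOf]
      simpa using Z1_le_Z1K b l hz
    intro x hx y hy
    obtain ⟨k, hk, hkx⟩ := key ⟨x, hx⟩
    obtain ⟨m, hm, hmy⟩ := key ⟨y, hy⟩
    have h1 : (QuotientGroup.mk ⁅k, m⁆ : Z1K b l' ⧸ (Z1K b l).subgroupOf (Z1K b l')) = 1 := by
      rw [QuotientGroup.eq_one_iff, Subgroup.mem_subgroupOf]
      exact K_le_Z1K b l (K_anti (by omega) (commutator_mem_K hϖ hk hm))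
    have h2 : (QuotientGroup.mk ⁅(⟨x, hx⟩ : Z1K b l'), ⟨y, hy⟩⁆ :
        Z1K b l' ⧸ (Z1K b l).subgroupOf (Z1K b l')) = 1 := by
      rw [← h1]
      simp only [commutatorElement_def, QuotientGroup.mk_mul, QuotientGroup.mk_inv, hkx, hmy]
    rwa [QuotientGroup.eq_one_iff, Subgroup.mem_subgroupOf] at h2
  · intro x hx
    obtain ⟨k, hk, z, hz, rfl⟩ := exists_eq_mul_of_mem_Z1K hx
    have h1 : (QuotientGroup.mk (⟨k * z, hx⟩ : Z1K b l') :
        Z1K b l' ⧸ (Z1K b l).subgroupOf (Z1K b l')) =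
        QuotientGroup.mk (⟨k, K_le_Z1K b l' hk⟩ : Z1K b l') := by
      refine (QuotientGroup.eq.2 ?_).symm
      rw [Subgroup.mem_subgroupOf]
      simpa using Z1_le_Z1K b l hz
    have h2 : (QuotientGroup.mk ((⟨k * z, hx⟩ : Z1K b l') ^ p) :
        Z1K b l' ⧸ (Z1K b l).subgroupOf (Z1K b l')) = 1 := by
      rw [QuotientGroup.mk_pow, h1, ← QuotientGroup.mk_pow, QuotientGroup.eq_one_iff,
        Subgroup.mem_subgroupOf]
      exact K_le_Z1K b l (hl ▸ pow_mem_K hϖ hl' hp hk)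
    rwa [QuotientGroup.eq_one_iff, Subgroup.mem_subgroupOf] at h2

include hϖ hl hr hφ in
-- For `g = 1 + ϖ ^ l' X` one gets `⁅g, z⁆ - 1 = ϖ ^ l' (X - z X z⁻¹)`, whose trace against `b`
-- vanishes because `z` commutes with `b`.
theorem apply_commutator_of_mem_Z1 {g z : Gr O r} (hg : g ∈ K O r l') (hz : z ∈ Z1 b)
    (h : ⁅g, z⁆ ∈ K O r l) : φ ⟨⁅g, z⁆, h⟩ = 1 := by
  obtain ⟨X, hX⟩ := (mem_K_iff hϖ).1 hg
  obtain ⟨X', hX'⟩ := (mem_K_iff hϖ).1 (inv_mem hg)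
  obtain ⟨Y, hY⟩ := (mem_K_iff hϖ).1 hz.2
  have h1 : g.val * z.val - z.val * g.val = ϖ ^ l' • (X * z.val - z.val * X) := by
    rw [hX]
    simp only [mul_add, add_mul, mul_one, one_mul, Matrix.mul_smul, Matrix.smul_mul, smul_sub]
    abel
  have h2 : X * z.val - z.val * X = ϖ • (X * Y - Y * X) := by
    rw [hY]
    simp only [mul_add, add_mul, mul_one, one_mul, Matrix.mul_smul, Matrix.smul_mul, smul_sub,
      pow_one]
    abel
  -- The left factor is divisible by `ϖ ^ (l' + 1)` and `g⁻¹ - 1` by `ϖ ^ l'`; the product of these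
  -- is zero as `2 l' + 1 = r`.
  have h3 : (g.val * z.val - z.val * g.val) * g⁻¹.val = g.val * z.val - z.val * g.val := by
    rw [hX', mul_add, mul_one, h1, h2, smul_smul, smul_mul_smul_comm, ← pow_succ, ← pow_add,
      hϖ.pow_eq_zero (show r ≤ l' + 1 + l' by omega), zero_smul, add_zero]
  have h4 : (z.val * X * z⁻¹.val * b).trace = (X * b).trace := by
    rw [Matrix.trace_mul_comm, trace_conj, ← mul_comm_val_of_mem_unitsAdjoin (inv_mem hz.1),
      mul_assoc b, Units.inv_mul, mul_one, Matrix.trace_mul_comm]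
  rw [hφ]
  simp only [commutator_val]
  rw [add_sub_cancel_left, h3, h1, Matrix.smul_mul, Matrix.mul_smul, Matrix.trace_smul,
    Matrix.trace_mul_comm, sub_mul, sub_mul, Matrix.trace_sub, h4, mul_assoc X, Units.mul_inv,
    mul_one, sub_self, smul_zero, AddChar.map_zero_eq_one]

include hϖ hl' hl hr hφ in
-- Terms beyond the additive commutator carry `ϖ ^ (3 l')`, which is zero since `3 l' ≥ 2 l' + 1 =
-- r`; cyclicity of the trace then moves the commutator from `X, Y` to `b, X`.
theorem apply_commutator_of_mem_K {x y : Gr O r} {X Y : Matrix (Fin 2) (Fin 2) (OMod O r)}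
    (hX : x.val = 1 + ϖ ^ l' • X) (hY : y.val = 1 + ϖ ^ l' • Y)
    (h : ⁅x, y⁆ ∈ K O r l) : φ ⟨⁅x, y⁆, h⟩ = ψ (ϖ ^ (l' + l') • (b * X - X * b) * Y).trace := by
  obtain ⟨X', hX'⟩ := (mem_K_iff hϖ).1 (inv_mem ((mem_K_iff hϖ).2 ⟨X, hX⟩))
  obtain ⟨Y', hY'⟩ := (mem_K_iff hϖ).1 (inv_mem ((mem_K_iff hϖ).2 ⟨Y, hY⟩))
  have h1 : x.val * y.val - y.val * x.val = ϖ ^ (l' + l') • (X * Y - Y * X) := by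
    rw [hX, hY]
    simp only [mul_add, add_mul, mul_one, one_mul, smul_mul_smul_comm, ← pow_add, smul_sub]
    abel
  have h2 : ∀ Z : Matrix (Fin 2) (Fin 2) (OMod O r),
      (x.val * y.val - y.val * x.val) * (1 + ϖ ^ l' • Z) = x.val * y.val - y.val * x.val := by
    intro Z
    rw [mul_add, mul_one, h1, smul_mul_smul_comm, ← pow_add,
      hϖ.pow_eq_zero (show r ≤ l' + l' + l' by omega), zero_smul,
      add_zero]
  rw [hφ]
  simp only [commutator_val]
  rw [add_sub_cancel_left, hX', h2, hY', h2, h1, Matrix.mul_smul, Matrix.smul_mul,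
    Matrix.trace_smul, Matrix.trace_smul, mul_sub, sub_mul, Matrix.trace_sub, Matrix.trace_sub,
    ← mul_assoc, ← mul_assoc, Matrix.trace_mul_comm (b * Y), ← mul_assoc]

variable {χ : Z1K b l →* ℂ} (hχ : ExtendsChar φ χ)

include hχ in
theorem ExtendsChar.apply {k : Gr O r} (hk : k ∈ K O r l) (hk' : k ∈ Z1K b l) :
    χ ⟨k, hk'⟩ = φ ⟨k, hk⟩ := by
  rw [← hχ]
  rfl

include hϖ hl' hl hr hann hψ hφ hb hχ in
-- With `g = c k`, conjugation by `c` fixes `Z¹` pointwise, and conjugation by `k` changes `Z¹` by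
-- commutators that `φ` kills. On `K_l` invariance is the definition of `T`.
theorem apply_conj_of_mem_stabilizer {g x : Gr O r} (hg : g ∈ stabilizer (oneDim φ))
    (hx : x ∈ Z1K b l) (h : g * x * g⁻¹ ∈ Z1K b l) : χ ⟨g * x * g⁻¹, h⟩ = χ ⟨x, hx⟩ := by
  obtain ⟨c, hc, k, hk, rfl⟩ := exists_eq_mul_of_mem_stabilizer hϖ hl' hl hr hann hb hψ hφ hg
  have hst : ∀ g ∈ stabilizer (oneDim φ), ∀ y (hy : y ∈ K O r l) (hy' : g * y * g⁻¹ ∈ Z1K b l),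
      χ ⟨g * y * g⁻¹, hy'⟩ = χ ⟨y, K_le_Z1K b l hy⟩ := by
    intro g hg y hy hy'
    rw [hχ.apply hy, hχ.apply ((K_normal l).conj_mem y hy g)]
    exact ((mem_stabilizer_oneDim.1 hg).2 _ _ rfl).symm
  have h1 : ∀ x (hx : x ∈ Z1K b l) (h : k * x * k⁻¹ ∈ Z1K b l),
      χ ⟨k * x * k⁻¹, h⟩ = χ ⟨x, hx⟩ := by
    intro x hx h
    obtain ⟨z, hz, y, hy, rfl⟩ := mem_Z1K_iff.1 hx
    have hz' : z ∈ Z1K b l := Z1_le_Z1K b l hz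
    have hcm := commutator_mem_K_of_mem_Z1 hϖ hl hk hz
    have hky := K_le_Z1K b l ((K_normal l).conj_mem y hy k)
    have e1 : (⟨k * (z * y) * k⁻¹, h⟩ : Z1K b l) =
        ⟨⁅k, z⁆, K_le_Z1K b l hcm⟩ * ⟨z, hz'⟩ * ⟨k * y * k⁻¹, hky⟩ := Subtype.ext (by
      simp only [Subgroup.coe_mul, commutatorElement_def]; group)
    have e2 : (⟨z * y, hx⟩ : Z1K b l) = ⟨z, hz'⟩ * ⟨y, K_le_Z1K b l hy⟩ := rfl
    rw [e1, e2, map_mul, map_mul, map_mul, hst k (K_le_stabilizer hϖ hl' hl hr hann hψ hφ hk) y hy,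
      hχ.apply hcm, apply_commutator_of_mem_Z1 hϖ hl hr hφ hk hz, one_mul]
  have h2 : ∀ x (hx : x ∈ Z1K b l) (h : c * x * c⁻¹ ∈ Z1K b l),
      χ ⟨c * x * c⁻¹, h⟩ = χ ⟨x, hx⟩ := by
    intro x hx h
    obtain ⟨z, hz, y, hy, rfl⟩ := mem_Z1K_iff.1 hx
    have hz' : z ∈ Z1K b l := Z1_le_Z1K b l hz
    have hcy := K_le_Z1K b l ((K_normal l).conj_mem y hy c)
    have e1 : (⟨c * (z * y) * c⁻¹, h⟩ : Z1K b l) = ⟨z, hz'⟩ * ⟨c * y * c⁻¹, hcy⟩ :=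
      Subtype.ext (by
        simp only [Subgroup.coe_mul]
        rw [← mul_assoc, mul_comm_of_mem_unitsAdjoin hc hz.1]; group)
    have e2 : (⟨z * y, hx⟩ : Z1K b l) = ⟨z, hz'⟩ * ⟨y, K_le_Z1K b l hy⟩ := rfl
    rw [e1, e2, map_mul, map_mul,
      hst c (unitsAdjoin_le_stabilizer hϖ hl' hl hr hann hψ hφ hc) y hy]
  have hkx : k * x * k⁻¹ ∈ Z1K b l := conj_mem_Z1K hϖ hl' hl hr hann hb hψ hφ le_rfl
    (K_le_stabilizer hϖ hl' hl hr hann hψ hφ hk) hx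
  have e : c * k * x * (c * k)⁻¹ = c * (k * x * k⁻¹) * c⁻¹ := by group
  have h' := h
  rw [e] at h'
  rw [← h1 x hx hkx, ← h2 _ hkx h']
  congr 2

include hϖ hl' hl hr hann hψ hφ hb hχ in
theorem stabilizer_le_stabilizer : stabilizer (oneDim φ) ≤ stabilizer (oneDim χ) := by
  intro g hg
  refine mem_stabilizer_oneDim.2 ⟨fun x => ⟨fun hx => conj_mem_Z1K hϖ hl' hl hr hann hb hψ hφ le_rfl
    hg hx, fun hx => ?_⟩, ?_⟩
  · have := conj_mem_Z1K hϖ hl' hl hr hann hb hψ hφ le_rfl (inv_mem hg) hx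
    simpa [mul_assoc] using this
  · rintro ⟨x, hx⟩ ⟨_, hy⟩ rfl
    exact (apply_conj_of_mem_stabilizer hϖ hl' hl hr hann hb hψ hφ hχ hg hx hy).symm

include hϖ hl' hl hr hann hψ hφ hb hχ in
/-- Non-degeneracy of the commutator form. -/
theorem mem_Z1K_of_forall_commutator {x : Gr O r} (hx : x ∈ Z1K b l')
    (h : ∀ y ∈ Z1K b l', ∀ hxy : ⁅x, y⁆ ∈ Z1K b l, χ ⟨⁅x, y⁆, hxy⟩ = 1) : x ∈ Z1K b l := by
  obtain ⟨z, hz, k, hk, rfl⟩ := mem_Z1K_iff.1 hx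
  have hz' : z ∈ Z1K b l := Z1_le_Z1K b l hz
  refine mul_mem hz' ?_
  obtain ⟨X, hX⟩ := (mem_K_iff hϖ).1 hk
  have h1 : ϖ ^ (l' + l') • (b * X - X * b) = 0 := by
    refine eq_zero_of_trace hψ fun Y => ?_
    obtain ⟨y, hy, hyY⟩ := exists_mem_K hϖ hl' Y
    have hky : ⁅k, y⁆ ∈ K O r l := K_anti (by omega) (commutator_mem_K hϖ hk hy)
    have hky' := K_le_Z1K b l hky
    have hyT := K_le_stabilizer hϖ hl' hl hr hann hψ hφ hy
    have hzT := Z1K_le_stabilizer hϖ hl' hl hr hann hψ hφ (by omega) hz'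
    have hyz := conj_mem_Z1K hϖ hl' hl hr hann hb hψ hφ le_rfl hyT (inv_mem hz')
    have hzky := conj_mem_Z1K hϖ hl' hl hr hann hb hψ hφ le_rfl hzT hky'
    -- Since `χ` is invariant under `T`, the factor `z` contributes `χ z * χ z⁻¹ = 1`, and only `⁅k,
    -- y⁆` remains.
    have e : ⁅z * k, y⁆ = z * ⁅k, y⁆ * z⁻¹ * (z * (y * z⁻¹ * y⁻¹)) := by
      simp only [commutatorElement_def]; group
    have hmem : ⁅z * k, y⁆ ∈ Z1K b l := by
      rw [e]
      exact mul_mem hzky (mul_mem hz' hyz)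
    have h2 := h y (K_le_Z1K b l' hy) hmem
    have e' : (⟨⁅z * k, y⁆, hmem⟩ : Z1K b l) =
        ⟨z * ⁅k, y⁆ * z⁻¹, hzky⟩ * (⟨z, hz'⟩ * ⟨y * z⁻¹ * y⁻¹, hyz⟩) := Subtype.ext e
    rw [e', map_mul, map_mul,
      apply_conj_of_mem_stabilizer hϖ hl' hl hr hann hb hψ hφ hχ hzT hky',
      apply_conj_of_mem_stabilizer hϖ hl' hl hr hann hb hψ hφ hχ hyT (inv_mem hz'),
      ← map_mul χ ⟨z, hz'⟩, hχ.apply hky, apply_commutator_of_mem_K hϖ hl' hl hr hφ hX hyY] at h2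
    have e3 : (⟨z, hz'⟩ * ⟨z⁻¹, inv_mem hz'⟩ : Z1K b l) = 1 := Subtype.ext (mul_inv_cancel z)
    rwa [e3, map_one, mul_one] at h2
  obtain ⟨W, hW⟩ := exists_eq_smul_of_smul_eq_zero hann (by omega) h1
  obtain ⟨s, t, Z, hZ⟩ := exists_eq_add_of_commutator hb hW
  rw [show r - (l' + l') = 1 by omega, pow_one] at hZ
  -- Now `X = s + t b` modulo `ϖ`, so `k` agrees with `z₀ ∈ Z¹` modulo `ϖ ^ (l' + 1) = ϖ ^ l`.
  obtain ⟨z₀, hz₀, hz₀v⟩ := exists_mem_K hϖ hl' (s • 1 + t • b)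
  have hz₀1 : z₀ ∈ Z1 b := by
    refine ⟨mem_unitsAdjoin_iff.2 ⟨1 + ϖ ^ l' * s, ϖ ^ l' * t, ?_⟩, K_anti hl' hz₀⟩
    rw [hz₀v]
    module
  have hk₀ : z₀⁻¹ * k ∈ K O r l := by
    refine (mem_K_iff hϖ).2 ⟨z₀⁻¹.val * Z, ?_⟩
    have e : k.val = z₀.val + ϖ ^ l • Z := by
      rw [hX, hz₀v, hZ, hl, pow_succ]
      module
    rw [Units.val_mul, e, mul_add, Units.inv_mul, Matrix.mul_smul]
  rw [← mul_inv_cancel_left z₀ k]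
  exact mul_mem (Z1_le_Z1K b l hz₀1) (K_le_Z1K b l hk₀)

end Stabilizer

/-! ### Extending and gluing linear characters -/

/-- The extension is `a * b ↦ f a * g b`: agreement on `A ∩ B` makes it well defined, and invariance
of `g` under `A` makes it multiplicative. -/
theorem exists_char_sup {G : Type*} [Group G] {A B : Subgroup G} [B.Normal] (f : A →* ℂ)
    (g : B →* ℂ) (hfg : ∀ x (ha : x ∈ A) (hb : x ∈ B), f ⟨x, ha⟩ = g ⟨x, hb⟩)
    (hconj : ∀ a ∈ A, ∀ x y : B, (y : G) = a * x * a⁻¹ → g x = g y) :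
    ∃ χ : ↥(A ⊔ B) →* ℂ, χ.comp (Subgroup.inclusion le_sup_right) = g := by
  have hdec : ∀ x : ↥(A ⊔ B), ∃ (a : A) (b : B), (x : G) = a * b := by
    rintro ⟨x, hx⟩
    rw [← SetLike.mem_coe, Subgroup.mul_normal, Set.mem_mul] at hx
    obtain ⟨a, ha, b, hb, rfl⟩ := hx
    exact ⟨⟨a, ha⟩, ⟨b, hb⟩, rfl⟩
  have hwd : ∀ (a a' : A) (b b' : B), (a : G) * b = a' * b' → f a * g b = f a' * g b' := by
    intro a a' b b' h
    have h1 : ((a'⁻¹ * a : A) : G) = (b' * b⁻¹ : B) := by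
      simp only [Subgroup.coe_mul, Subgroup.coe_inv]
      rw [eq_mul_inv_iff_mul_eq, mul_assoc, h, inv_mul_cancel_left]
    have h2 : f (a'⁻¹ * a) = g (b' * b⁻¹) := by
      exact (hfg _ (a'⁻¹ * a).2 (h1 ▸ (b' * b⁻¹).2)).trans (congrArg g (Subtype.ext h1))
    rw [← mul_inv_cancel_left a' a, map_mul, h2, mul_assoc, ← map_mul, inv_mul_cancel_right]
  choose α γ h using hdec
  refine ⟨⟨⟨fun x => f (α x) * g (γ x), ?_⟩, fun x y => ?_⟩, ?_⟩
  · have := hwd (α 1) 1 (γ 1) 1 (by rw [← h]; simp)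
    simpa using this
  · have h1 := hwd (α (x * y)) (α x * α y) (γ (x * y))
      (⟨(α y : G)⁻¹ * γ x * α y, by
        simpa using ‹B.Normal›.conj_mem (γ x) (γ x).2 (α y : G)⁻¹⟩ * γ y) (by
        rw [← h, Subgroup.coe_mul, h x, h y]
        simp [mul_assoc])
    have h2 := hconj (α y : G) (α y).2 ⟨(α y : G)⁻¹ * γ x * α y, by
        simpa using ‹B.Normal›.conj_mem (γ x) (γ x).2 (α y : G)⁻¹⟩ (γ x) (by
        simp [mul_assoc])
    simp only [h1, map_mul, h2]
    ring
  · ext x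
    have h1 := hwd (α (Subgroup.inclusion le_sup_right x)) 1
      (γ (Subgroup.inclusion le_sup_right x)) x (by rw [← h]; simp)
    simpa using h1

theorem exists_extension_of_comm {G : Type*} [CommGroup G] [Finite G] (H : Subgroup G)
    (f : H →* ℂ) : ∃ g : G →* ℂ, ∀ h : H, g h = f h := by
  have : NeZero (Monoid.exponent G) := ⟨Monoid.exponent_ne_zero_of_finite⟩
  obtain ⟨g, hg⟩ := MonoidHom.domRestrict_surjective ℂ H f.toHomUnits
  refine ⟨(Units.coeHom ℂ).comp g, fun h => ?_⟩
  have := congrArg Units.val (DFunLike.congr_fun hg h)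
  simpa using this

/-! ### Cyclicity of groups mapping to `k[b]ˣ` -/

section Cyclic

variable {k : Type*} [Field k] {b : Matrix (Fin 2) (Fin 2) k}

open scoped IsMulCommutative in
-- By `hb` the finite commutative ring `k[b]` is a domain, so the image of `G` in its unit group is
-- cyclic.
theorem exists_cyclic_generator [Finite k]
    (hb : ∀ s t : k, s • 1 + t • b ≠ 0 → IsUnit (s • 1 + t • b))
    {G : Type*} [Group G] (f : G →* Matrix (Fin 2) (Fin 2) k)
    (hf : ∀ g, f g ∈ Algebra.adjoin k {b}) :
    ∃ c, ∀ x, ∃ (n : ℤ) (z : G), f z = 1 ∧ x = c ^ n * z := by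
  have := Algebra.isMulCommutative_adjoin k (s := {b}) (by simp)
  have : NoZeroDivisors (Algebra.adjoin k {b}) := by
    refine ⟨fun {x y} hxy => or_iff_not_imp_left.2 fun hx => ?_⟩
    obtain ⟨s, t, hst⟩ := mem_adjoin_iff.1 x.2
    have hu : IsUnit x.val := by
      rw [hst]
      refine hb s t fun h => hx (Subtype.ext (hst.trans h))
    exact Subtype.ext (hu.mul_right_eq_zero.1 (congrArg Subtype.val hxy))
  have : IsDomain (Algebra.adjoin k {b}) := NoZeroDivisors.to_isDomain _
  have : Finite (Algebra.adjoin k {b}) := Subtype.finite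
  let F : G →* (Algebra.adjoin k {b}) :=
    { toFun := fun g => ⟨f g, hf g⟩
      map_one' := Subtype.ext (map_one f)
      map_mul' := fun x y => Subtype.ext (map_mul f x y) }
  obtain ⟨⟨_, c, rfl⟩, hc⟩ := IsCyclic.exists_generator (α := F.toHomUnits.range)
  refine ⟨c, fun x => ?_⟩
  obtain ⟨n, hn⟩ := Subgroup.mem_zpowers_iff.1 (hc ⟨F.toHomUnits x, x, rfl⟩)
  refine ⟨n, (c ^ n)⁻¹ * x, ?_, by group⟩
  have h1 : F.toHomUnits ((c ^ n)⁻¹ * x) = 1 := by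
    rw [map_mul, map_inv, map_zpow, inv_mul_eq_one]
    exact congrArg Subtype.val hn
  exact congrArg (fun u : (Algebra.adjoin k {b})ˣ => u.val.val) h1

end Cyclic

/-! ### Existence of `χ`, a generator of `T / Z¹ K_{l'}`, and bilinearity -/

section Stabilizer

variable {O : Type*} [CommRing O] [IsLocalRing O] {r l l' : ℕ} {ϖ : OMod O r}
  (hϖ : IsUniformizer ϖ) (hl' : 1 ≤ l') (hl : l = l' + 1) (hr : r = l + l')
  (hann : ∀ i ≤ r, ∀ a : OMod O r, ϖ ^ i * a = 0 → ϖ ^ (r - i) ∣ a)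
  {b : Matrix (Fin 2) (Fin 2) (OMod O r)} (hb : IsUnit (b 1 0))
  {ψ : AddChar (OMod O r) ℂ} (hψ : ∀ a : OMod O r, (∀ y, ψ (a * y) = 1) → a = 0)
  {φ : K O r l →* ℂ} (hφ : ∀ x : K O r l, φ x = ψ (b * (x.val.val - 1)).trace)

include hϖ hl' hl hr hann hψ hφ in
-- Extend `φ` from `Z¹ ∩ K_l` to the abelian group `Z¹`, then glue with `φ`, which `Z¹` fixes.
theorem exists_extendsChar [Finite (Gr O r)] : ∃ χ : Z1K b l →* ℂ, ExtendsChar φ χ := by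
  let : CommGroup (Z1 b) :=
    { (inferInstance : Group (Z1 b)) with
      mul_comm := fun x y => Subtype.ext (mul_comm_of_mem_unitsAdjoin x.2.1 y.2.1) }
  let f : (K O r l).subgroupOf (Z1 b) →* ℂ :=
    { toFun := fun x => φ ⟨x.1.1, x.2⟩
      map_one' := map_one φ
      map_mul' := fun x y => map_mul φ ⟨x.1.1, x.2⟩ ⟨y.1.1, y.2⟩ }
  obtain ⟨g, hg⟩ := exists_extension_of_comm _ f
  refine exists_char_sup g φ (fun x ha hb => hg ⟨⟨x, ha⟩, hb⟩) fun a ha x y hxy => ?_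
  exact (mem_stabilizer_oneDim.1
    (unitsAdjoin_le_stabilizer hϖ hl' hl hr hann hψ hφ ha.1)).2 x y hxy

include hϖ hl' hl hr hann hψ hφ hb in
-- Reduction modulo `ϖ` maps `O_r[b]ˣ` to `k[b]ˣ` with kernel `Z¹`, and `K_{l'}` accounts for the
-- rest of `T`.
theorem exists_generator {k : Type*} [Field k] [Finite k] (ρ : OMod O r →+* k)
    (hρ : ∀ a, ρ a = 0 → ϖ ∣ a)
    (hbk : ∀ s t : k, s • 1 + t • b.map ρ ≠ 0 → IsUnit (s • 1 + t • b.map ρ)) :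
    ∃ c ∈ stabilizer (oneDim φ), ∀ x ∈ stabilizer (oneDim φ),
      ∃ (n : ℤ), ∃ h ∈ Z1K b l', x = c ^ n * h := by
  let f : unitsAdjoin b →* Matrix (Fin 2) (Fin 2) k :=
    (ρ.mapMatrix (m := Fin 2)).toMonoidHom.comp
      ((Units.coeHom _).comp (unitsAdjoin b).subtype)
  have hf : ∀ g, f g ∈ Algebra.adjoin k {b.map ρ} := by
    rintro ⟨g, hg⟩
    obtain ⟨s, t, hst⟩ := mem_unitsAdjoin_iff.1 hg
    refine mem_adjoin_iff.2 ⟨ρ s, ρ t, ?_⟩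
    change ρ.mapMatrix g.val = _
    rw [hst, map_add]
    congr 1
    · ext i j
      simp only [RingHom.mapMatrix_apply, Matrix.map_apply, Matrix.smul_apply, smul_eq_mul, map_mul,
        Matrix.one_apply]
      split_ifs <;> simp
    · ext i j
      simp
  obtain ⟨⟨c, hc⟩, hgen⟩ := exists_cyclic_generator hbk f hf
  refine ⟨c, unitsAdjoin_le_stabilizer hϖ hl' hl hr hann hψ hφ hc, fun x hx => ?_⟩
  obtain ⟨d, hd, m, hm, rfl⟩ := exists_eq_mul_of_mem_stabilizer hϖ hl' hl hr hann hb hψ hφ hx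
  obtain ⟨n, ⟨z, hz⟩, hz1, hdz⟩ := hgen ⟨d, hd⟩
  have hd' : d = c ^ n * z := congrArg Subtype.val hdz
  refine ⟨n, z * m, mul_mem (Z1_le_Z1K b l' ⟨hz, (mem_K_iff hϖ).2 ?_⟩) (K_le_Z1K b l' hm),
    by rw [hd', mul_assoc]⟩
  have h1 : ∀ i j, ϖ ∣ (z.val - 1) i j := by
    intro i j
    refine hρ _ ?_
    have h2 := congrFun (congrFun hz1 i) j
    change ρ (z.val i j) = _ at h2
    rw [Matrix.sub_apply, map_sub, h2, Matrix.one_apply, Matrix.one_apply]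
    split_ifs <;> simp
  choose Y hY using h1
  refine ⟨Matrix.of Y, ?_⟩
  ext i j
  rw [pow_one, Matrix.add_apply, Matrix.smul_apply, smul_eq_mul, Matrix.of_apply, ← hY,
    Matrix.sub_apply, add_sub_cancel]

variable {χ : Z1K b l →* ℂ} (hχ : ExtendsChar φ χ)

include hϖ hl' hl hr hann hψ hφ hb hχ in
-- Bilinearity comes from identities such as `⁅xy, z⁆ = x ⁅y, z⁆ x⁻¹ ⁅x, z⁆`, where invariance of
-- `χ` removes the conjugation; the same invariance makes the form trivial on `Z¹ K_l` in either
-- variable.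
theorem hasNondegenerateCommutatorForm_Z1K
    (hcomm : ∀ x ∈ Z1K b l', ∀ y ∈ Z1K b l', ⁅x, y⁆ ∈ Z1K b l) :
    HasNondegenerateCommutatorForm (Z1K b l) (Z1K b l') χ := by
  have hle := Z1K_le_stabilizer (i := l') hϖ hl' hl hr hann hψ hφ le_rfl
  have hn := normal_subgroupOf_stabilizer hϖ hl' hl hr hann hb hψ hφ le_rfl hle
  have hst : ∀ g ∈ Z1K b l', ∀ x (hx : x ∈ Z1K b l) (h : g * x * g⁻¹ ∈ Z1K b l),
      χ ⟨g * x * g⁻¹, h⟩ = χ ⟨x, hx⟩ := fun g hg x hx h =>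
    apply_conj_of_mem_stabilizer hϖ hl' hl hr hann hb hψ hφ hχ (hle hg) hx h
  have hcj : ∀ g ∈ Z1K b l', ∀ x ∈ Z1K b l, g * x * g⁻¹ ∈ Z1K b l := fun g hg x hx =>
    conj_mem_Z1K hϖ hl' hl hr hann hb hψ hφ le_rfl (hle hg) hx
  let B : Z1K b l' → Z1K b l' → ℂ := fun x y => χ ⟨⁅x.1, y.1⁆, hcomm x x.2 y y.2⟩
  have hBl : ∀ x y z, B (x * y) z = B x z * B y z := by
    intro x y z
    have e : (⟨⁅x.1 * y.1, z.1⁆, hcomm _ (x * y).2 z z.2⟩ : Z1K b l) =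
        ⟨x.1 * ⁅y.1, z.1⁆ * x.1⁻¹, hcj _ x.2 _ (hcomm y y.2 z z.2)⟩ *
          ⟨⁅x.1, z.1⁆, hcomm x x.2 z z.2⟩ := Subtype.ext (by
      simp only [Subgroup.coe_mul, commutatorElement_def]; group)
    change χ ⟨⁅x.1 * y.1, z.1⁆, _⟩ = _
    rw [e, map_mul, hst _ x.2 _ (hcomm y y.2 z z.2), mul_comm]
  have hBr : ∀ x y z, B x (y * z) = B x y * B x z := by
    intro x y z
    have e : (⟨⁅x.1, y.1 * z.1⁆, hcomm x x.2 _ (y * z).2⟩ : Z1K b l) =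
        ⟨⁅x.1, y.1⁆, hcomm x x.2 y y.2⟩ *
        ⟨y.1 * ⁅x.1, z.1⁆ * y.1⁻¹, hcj _ y.2 _ (hcomm x x.2 z z.2)⟩ := Subtype.ext (by
      simp only [Subgroup.coe_mul, commutatorElement_def]; group)
    change χ ⟨⁅x.1, y.1 * z.1⁆, _⟩ = _
    rw [e, map_mul, hst _ y.2 _ (hcomm x x.2 z z.2)]
  have hBa : ∀ x, B x x = 1 := by
    intro x
    have e : (⟨⁅x.1, x.1⁆, hcomm x x.2 x x.2⟩ : Z1K b l) = 1 :=
      Subtype.ext (commutatorElement_self _)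
    change χ _ = 1
    rw [e, map_one]
  have hB1 : ∀ n x : Z1K b l', (n : Gr O r) ∈ Z1K b l → B n x = 1 := by
    intro n x hnm
    have e : (⟨⁅n.1, x.1⁆, hcomm n n.2 x x.2⟩ : Z1K b l) =
        ⟨n.1, hnm⟩ * ⟨x.1 * n.1⁻¹ * x.1⁻¹, hcj _ x.2 _ (inv_mem hnm)⟩ := Subtype.ext (by
      simp only [Subgroup.coe_mul, commutatorElement_def]; group)
    have e' : (⟨n.1, hnm⟩ * ⟨n.1⁻¹, inv_mem hnm⟩ : Z1K b l) = 1 := Subtype.ext (mul_inv_cancel _)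
    change χ _ = 1
    rw [e, map_mul, hst _ x.2 _ (inv_mem hnm), ← map_mul, e', map_one]
  have hB1' : ∀ x n : Z1K b l', (n : Gr O r) ∈ Z1K b l → B x n = 1 := by
    intro x n hnm
    have e : (⟨⁅x.1, n.1⁆, hcomm x x.2 n n.2⟩ : Z1K b l) =
        ⟨x.1 * n.1 * x.1⁻¹, hcj _ x.2 _ hnm⟩ * ⟨n.1⁻¹, inv_mem hnm⟩ := rfl
    have e' : (⟨n.1, hnm⟩ * ⟨n.1⁻¹, inv_mem hnm⟩ : Z1K b l) = 1 := Subtype.ext (mul_inv_cancel _)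
    change χ _ = 1
    rw [e, map_mul, hst _ x.2 _ hnm, ← map_mul, e', map_one]
  refine ⟨hn, Quotient.lift₂ B fun x y x' y' hx hy => ?_, fun x y => ⟨hcomm x x.2 y y.2, rfl⟩,
    ?_, ?_, ?_, ?_⟩
  · have hx' : x⁻¹ * x' ∈ (Z1K b l).subgroupOf (Z1K b l') := QuotientGroup.leftRel_apply.1 hx
    have hy' : y⁻¹ * y' ∈ (Z1K b l).subgroupOf (Z1K b l') := QuotientGroup.leftRel_apply.1 hy
    rw [← mul_inv_cancel_left x x', ← mul_inv_cancel_left y y', hBl,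
      hB1 _ _ (Subgroup.mem_subgroupOf.1 hx'), hBr, hB1' _ _ (Subgroup.mem_subgroupOf.1 hy'), mul_one, mul_one]
  · rintro ⟨x⟩ ⟨y⟩ ⟨z⟩
    exact hBl x y z
  · rintro ⟨x⟩ ⟨y⟩ ⟨z⟩
    exact hBr x y z
  · rintro ⟨x⟩
    exact hBa x
  · rintro ⟨x⟩ h
    refine (QuotientGroup.eq_one_iff x).2 ?_
    exact mem_Z1K_of_forall_commutator hϖ hl' hl hr hann hb hψ hφ hχ x.2
      fun y hy _ => h (QuotientGroup.mk ⟨y, hy⟩)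

end Stabilizer

/-! ### Representations along `N ≤ H ≤ T` over a `T`-stable character -/

section Tower

variable {G : Type*} [Group G] {N H T : Subgroup G} (hNH : N ≤ H) (hHT : H ≤ T)
  (hcH : ∀ t ∈ T, ∀ x ∈ H, t * x * t⁻¹ ∈ H)
  {χ : N →* ℂ} (hχ : T ≤ stabilizer (oneDim χ))
  (hnd : ∀ x ∈ H, x ∉ N → ∃ y ∈ H, ∃ h : ⁅y, x⁆ ∈ N, χ ⟨⁅y, x⁆, h⟩ ≠ 1)
  {V W : Type*} [AddCommGroup V] [Module ℂ V] [AddCommGroup W] [Module ℂ W]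

include hχ in
theorem exists_conj_eq {X : Subgroup G} (hX : X ≤ T) (hNX : N ≤ X) (g : X) (n : N) :
    ∃ n' : N, Subgroup.inclusion hNX n' = g * Subgroup.inclusion hNX n * g⁻¹ ∧ χ n' = χ n := by
  obtain ⟨h1, h2⟩ := mem_stabilizer_oneDim.1 (hχ (hX g.2))
  exact ⟨⟨g * n * g⁻¹, (h1 n).1 n.2⟩, rfl, (h2 n _ rfl).symm⟩

include hχ in
theorem isScalarOn_of_eigenvector {X : Subgroup G} (hX : X ≤ T) (hNX : N ≤ X)
    {ρ : Representation ℂ X V} (hρ : ρ.IsIrreducible) {v : V} (hv : v ≠ 0)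
    (h : ∀ n, ρ (Subgroup.inclusion hNX n) v = χ n • v) : IsScalarOn hNX χ ρ := by
  have key := eigenspace_eq_top hρ (f := Subgroup.inclusion hNX) (c := χ) (fun g n => by
    obtain ⟨n', h1, h2⟩ := exists_conj_eq hχ hX hNX g⁻¹ n
    exact ⟨n', by rw [h1]; group, h2⟩) hv h
  intro n w
  exact (key ▸ Submodule.mem_top : w ∈ eigenspace ρ (Subgroup.inclusion hNX) χ) n

include hχ in
theorem isScalarOn_of_contains {X : Subgroup G} (hX : X ≤ T) (hNX : N ≤ X)
    {ρ : Representation ℂ X V} (hρ : ρ.IsIrreducible)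
    (h : Contains (ρ.comp (Subgroup.inclusion hNX)) (oneDim χ)) : IsScalarOn hNX χ ρ := by
  obtain ⟨v, hv, h⟩ := contains_oneDim_iff.1 h
  exact isScalarOn_of_eigenvector hχ hX hNX hρ hv h

theorem IsScalarOn.contains [Nontrivial V] {X : Subgroup G} {hNX : N ≤ X}
    {ρ : Representation ℂ X V} (h : IsScalarOn hNX χ ρ) :
    Contains (ρ.comp (Subgroup.inclusion hNX)) (oneDim χ) := by
  obtain ⟨v, hv⟩ := exists_ne (0 : V)
  exact contains_oneDim_iff.2 ⟨v, hv, fun n => h n v⟩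

include hnd in
theorem equiv_of_isScalarOn [Finite G] {η : Representation ℂ H V} {η' : Representation ℂ H W}
    (hirr : η.IsIrreducible) (hirr' : η'.IsIrreducible)
    (hη : IsScalarOn hNH χ η) (hη' : IsScalarOn hNH χ η') :
    Nonempty (Representation.Equiv η η') := by
  refine nonempty_equiv_of_scalar (Subgroup.inclusion hNH) χ (fun x hx => ?_) hirr hirr' hη hη'
  obtain ⟨y, hy, h, hne⟩ := hnd x x.2 fun hxN => hx ⟨⟨x, hxN⟩, rfl⟩
  exact ⟨⟨y, hy⟩, ⟨_, h⟩, rfl, hne⟩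

include hcH hHT hχ hnd in
-- A conjugate of `η` by `t ∈ T` is irreducible and still lies over `χ`, so uniqueness identifies it
-- with `η`.
theorem le_stabilizer_of_isScalarOn [Finite G] {η : Representation ℂ H V} (hirr : η.IsIrreducible)
    (hη : IsScalarOn hNH χ η) : T ≤ stabilizer η := by
  intro t ht
  have hiff : ∀ x, x ∈ H ↔ t * x * t⁻¹ ∈ H := fun x => ⟨fun hx => hcH t ht x hx, fun hx => by
    have := hcH _ (inv_mem ht) _ hx
    simpa [mul_assoc] using this⟩
  let σ : H →* H :=
    { toFun := fun x => ⟨t * x * t⁻¹, hcH t ht x x.2⟩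
      map_one' := by simp
      map_mul' := fun x y => Subtype.ext (by simp [mul_assoc]) }
  have := nontrivial_of_isIrreducible hirr
  have hirr' : Representation.IsIrreducible (η.comp σ) := by
    refine isIrreducible_of_forall fun U hU => eq_bot_or_eq_top_of_isIrreducible hirr U
      fun x v hv => ?_
    have hx : σ ⟨t⁻¹ * x * t, by
        simpa using hcH _ (inv_mem ht) x x.2⟩ = x := Subtype.ext (by simp [σ, mul_assoc])
    rw [← hx]
    exact hU _ v hv
  have hη' : IsScalarOn hNH χ (η.comp σ : Representation ℂ H V) := by
    intro n v
    obtain ⟨n', hn', hχn⟩ := exists_conj_eq hχ le_rfl (hNH.trans hHT) ⟨t, ht⟩ n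
    have : σ (Subgroup.inclusion hNH n) = Subgroup.inclusion hNH n' :=
      Subtype.ext (congrArg Subtype.val hn').symm
    rw [MonoidHom.comp_apply, this, hη, hχn]
  obtain ⟨e⟩ := equiv_of_isScalarOn hNH hnd hirr hirr' hη hη'
  refine ⟨hiff, e.toLinearEquiv, fun x y hxy v => ?_⟩
  have h1 := Representation.IntertwiningMap.isIntertwining _ _ e.toIntertwiningMap x v
  have h2 : σ x = y := Subtype.ext hxy.symm
  rw [MonoidHom.comp_apply, h2] at h1
  exact h1

variable {c : G} (hcT : c ∈ T) (hc : ∀ x ∈ T, ∃ (n : ℤ), ∃ h ∈ H, x = c ^ n * h)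

include hcH in
theorem exists_inclusion_eq_conj (t : T) (h : H) :
    ∃ h' : H, Subgroup.inclusion hHT h' = t * Subgroup.inclusion hHT h * t⁻¹ :=
  ⟨⟨t * h * t⁻¹, hcH t t.2 h h.2⟩, rfl⟩

include hc in
theorem exists_eq_zpow_mul_inclusion (x : T) :
    ∃ (n : ℤ) (h : H), x = ⟨c, hcT⟩ ^ n * Subgroup.inclusion hHT h := by
  obtain ⟨n, h, hh, hx⟩ := hc x x.2
  exact ⟨n, ⟨h, hh⟩, Subtype.ext (by simpa using hx)⟩

include hcH hcT hc in
theorem exists_extension_of_le_stabilizer [Finite G] {η : Representation ℂ H V}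
    (hirr : η.IsIrreducible) (hst : T ≤ stabilizer η) :
    ∃ θ : Representation ℂ T V, θ.comp (Subgroup.inclusion hHT) = η := by
  refine exists_extension (Subgroup.inclusion_injective hHT)
    (exists_inclusion_eq_conj hHT hcH) hirr ⟨c, hcT⟩
    (exists_eq_zpow_mul_inclusion hHT hcT hc) ?_
  obtain ⟨-, e, he⟩ := hst hcT
  refine ⟨LinearMap.GeneralLinearGroup.ofLinearEquiv e, fun h h' hh => LinearMap.ext fun v => ?_⟩
  exact he h h' (congrArg Subtype.val hh) v

include hcT hc in
theorem isCyclic_quotient [(H.subgroupOf T).Normal] : IsCyclic (T ⧸ H.subgroupOf T) := by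
  refine ⟨QuotientGroup.mk ⟨c, hcT⟩, ?_⟩
  rintro ⟨x⟩
  obtain ⟨n, h, hh, hx⟩ := hc x x.2
  refine ⟨n, ?_⟩
  change (QuotientGroup.mk ⟨c, hcT⟩ : T ⧸ H.subgroupOf T) ^ n = QuotientGroup.mk x
  rw [← QuotientGroup.mk_zpow, QuotientGroup.eq, Subgroup.mem_subgroupOf]
  simpa [hx] using hh

include hcH hχ hnd hcT hc in
-- An irreducible `H`-subrepresentation of `θ` lies over `χ`, hence is stable under `T` and extends
-- to `T`; `isIrreducible_comp_of_extension` compares this extension with `θ`.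
theorem isIrreducible_comp_inclusion [Finite G] {θ : Representation ℂ T V} (hθ : θ.IsIrreducible)
    (hs : IsScalarOn (hNH.trans hHT) χ θ) :
    Representation.IsIrreducible (θ.comp (Subgroup.inclusion hHT)) := by
  have := nontrivial_of_isIrreducible hθ
  obtain ⟨U, hU⟩ := exists_isIrreducible_toRepresentation (G := H)
    (θ.comp (Subgroup.inclusion hHT))
  have hUs : IsScalarOn hNH χ U.toRepresentation := fun n u => Subtype.ext (hs n u)
  obtain ⟨η, hη⟩ := exists_extension_of_le_stabilizer hHT hcH hcT hc hU
    (le_stabilizer_of_isScalarOn hNH hHT hcH hχ hnd hU hUs)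
  refine isIrreducible_comp_of_extension (exists_inclusion_eq_conj hHT hcH) ⟨c, hcT⟩
    (exists_eq_zpow_mul_inclusion hHT hcT hc) (η := η) (hη.symm ▸ hU) hθ U.toSubmodule.subtype ?_ ?_
  · intro h0
    have := nontrivial_of_isIrreducible hU
    obtain ⟨u, hu⟩ := exists_ne (0 : U.toSubmodule)
    exact hu (Subtype.ext (LinearMap.congr_fun h0 u))
  · intro h v
    have h1 : η (Subgroup.inclusion hHT h) = U.toRepresentation h := DFunLike.congr_fun hη h
    rw [h1]
    rfl

end Tower

theorem isScalarOn_of_contains_ind {G : Type*} [Group G] {K T : Subgroup G} {φ : K →* ℂ}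
    (hT : T = stabilizer (oneDim φ)) (hKT : K ≤ T) {V : Type*} [AddCommGroup V] [Module ℂ V]
    {θ : Representation ℂ T V}
    (h : Contains (Representation.ind (Subgroup.inclusion hKT) (oneDim φ)) θ) :
    IsScalarOn hKT φ θ := by
  obtain ⟨f, hf⟩ := h
  intro k v
  refine hf ?_
  have h1 := Representation.IntertwiningMap.isIntertwining _ _ f (Subgroup.inclusion hKT k) v
  rw [h1, ind_oneDim_apply (Subgroup.inclusion hKT) φ (fun g k => by
    obtain ⟨k', hk, hφk⟩ := conj_mem_of_mem_stabilizer hT g k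
    exact ⟨k', Subtype.ext hk, hφk⟩) k (f v)]
  exact (map_smul f (φ k) v).symm

theorem isScalarOn_comp_iff {G : Type*} [Group G] {N H X : Subgroup G} {hNH : N ≤ H} {hHX : H ≤ X}
    {χ : N →* ℂ} {V : Type*} [AddCommGroup V] [Module ℂ V] {ρ : Representation ℂ X V} :
    IsScalarOn hNH χ (ρ.comp (Subgroup.inclusion hHX) : Representation ℂ H V) ↔
      IsScalarOn (hNH.trans hHX) χ ρ :=
  Iff.rfl

theorem IsScalarOn.of_comp {G : Type*} [Group G] {K N X : Subgroup G} {hNX : N ≤ X} {χ : N →* ℂ}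
    {V : Type*} [AddCommGroup V] [Module ℂ V] {ρ : Representation ℂ X V}
    (hs : IsScalarOn hNX χ ρ) (hKN : K ≤ N) {φ : K →* ℂ}
    (hχ : χ.comp (Subgroup.inclusion hKN) = φ) : IsScalarOn (hKN.trans hNX) φ ρ := by
  subst hχ
  exact fun k v => hs (Subgroup.inclusion hKN k) v

/-- A representation on which `K` acts by `φ` has an eigenvector for `Z ⊔ K`, for `Z` abelian. -/
theorem exists_eigenvector {G : Type*} [Group G] [Finite G] {Z K N T : Subgroup G} [K.Normal]
    (hZ : ∀ x ∈ Z, ∀ y ∈ Z, x * y = y * x) (hKN : K ≤ N) (hN : N = Z ⊔ K) (hT : N ≤ T) {φ : K →* ℂ}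
    {V : Type*} [AddCommGroup V] [Module ℂ V] [Nontrivial V]
    {θ : Representation ℂ T V} (hs : IsScalarOn (hKN.trans hT) φ θ) :
    ∃ χ : N →* ℂ, χ.comp (Subgroup.inclusion hKN) = φ ∧
      ∃ v ≠ 0, ∀ n, θ (Subgroup.inclusion hT n) v = χ n • v := by
  subst hN
  have : IsMulCommutative Z := ⟨⟨fun x y => Subtype.ext (hZ x x.2 y y.2)⟩⟩
  -- An irreducible representation of the abelian group `Z` is a line, and `K` preserves this line
  -- because it acts by scalars.
  obtain ⟨U, hU⟩ := exists_isIrreducible_toRepresentation (G := Z)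
    (θ.comp (Subgroup.inclusion (le_sup_left.trans hT)))
  have := finiteDimensional_of_isIrreducible hU
  have := nontrivial_of_isIrreducible hU
  have h1 := Representation.IsIrreducible.finrank_eq_one_of_isMulCommutative U.toRepresentation
  obtain ⟨u, hu⟩ := exists_ne (0 : U.toSubmodule)
  have hu0 : (u : V) ≠ 0 := fun h => hu (Subtype.ext h)
  have key : ∀ n : ↥(Z ⊔ K), ∃ a : ℂ, θ (Subgroup.inclusion hT n) u = a • (u : V) := by
    rintro ⟨n, hn⟩
    have hn' := hn
    rw [← SetLike.mem_coe, Subgroup.mul_normal, Set.mem_mul] at hn'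
    obtain ⟨z, hz, k, hk, rfl⟩ := hn'
    obtain ⟨a, ha⟩ := (finrank_eq_one_iff_of_nonzero' u hu).1 h1 (U.toRepresentation ⟨z, hz⟩ u)
    have h2 : Subgroup.inclusion hT ⟨z * k, hn⟩ =
      Subgroup.inclusion (le_sup_left.trans hT) ⟨z, hz⟩ *
      Subgroup.inclusion (le_sup_right.trans hT) ⟨k, hk⟩ := rfl
    refine ⟨φ ⟨k, hk⟩ * a, ?_⟩
    rw [h2, map_mul, Module.End.mul_apply, hs, map_smul, mul_smul]
    exact congrArg (φ ⟨k, hk⟩ • ·) (congrArg Subtype.val ha).symm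
  choose χ hχ using key
  refine ⟨⟨⟨χ, ?_⟩, fun x y => ?_⟩, ?_, u, hu0, hχ⟩
  · have := hχ 1
    rw [map_one, map_one, Module.End.one_apply] at this
    exact smul_left_injective ℂ hu0 (by simpa using this.symm)
  · have := hχ (x * y)
    rw [map_mul, map_mul, Module.End.mul_apply, hχ y, map_smul, hχ x, smul_smul] at this
    exact smul_left_injective ℂ hu0 (by simpa [mul_comm] using this.symm)
  · ext k
    have h2 := hs k u
    have h3 := hχ (Subgroup.inclusion le_sup_right k)
    exact smul_left_injective ℂ hu0 (h3.symm.trans h2)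

/-! ### The quotients `O / 𝔭 ^ r` of a discrete valuation ring -/

section DVR

variable {O : Type*} [CommRing O] [IsDomain O] [IsDiscreteValuationRing O] {r : ℕ}

theorem finite_OMod [Finite (ResidueField O)] (n : ℕ) : Finite (OMod O n) := by
  have : Finite (O ⧸ maximalIdeal O) := inferInstanceAs (Finite (ResidueField O))
  exact Ideal.finite_quotient_pow (IsNoetherian.noetherian _) n

variable {p : O} (hp : Irreducible p)

include hp in
theorem toOMod_eq_zero_iff {x : O} : toOMod O r x = 0 ↔ p ^ r ∣ x := by
  rw [Ideal.Quotient.eq_zero_iff_mem, hp.maximalIdeal_eq, Ideal.span_singleton_pow,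
    Ideal.mem_span_singleton]

include hp in
theorem isUniformizer_of_irreducible : IsUniformizer (toOMod O r p) := by
  intro i
  have h : maximalIdeal O ^ i = Ideal.span {p ^ i} := by
    rw [hp.maximalIdeal_eq, Ideal.span_singleton_pow]
  rw [h, Ideal.map_span, Set.image_singleton, map_pow]

include hp in
theorem pow_dvd_of_pow_mul_eq_zero {i : ℕ} (hi : i ≤ r) {a : OMod O r}
    (h : toOMod O r p ^ i * a = 0) : toOMod O r p ^ (r - i) ∣ a := by
  obtain ⟨x, rfl⟩ := Ideal.Quotient.mk_surjective a
  rw [← map_pow, ← map_mul, toOMod_eq_zero_iff hp] at h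
  obtain ⟨j, rfl⟩ := Nat.exists_eq_add_of_le hi
  rw [pow_add, mul_dvd_mul_iff_left (pow_ne_zero _ hp.ne_zero)] at h
  rw [Nat.add_sub_cancel_left, ← map_pow]
  exact map_dvd _ h

/-- The additive character of `O / 𝔭 ^ r` attached to one of `O` that is trivial on `𝔭 ^ r`. -/
def quotientChar {ψ : AddChar O ℂ} (hψ : HasConductor ψ r) : AddChar (OMod O r) ℂ where
  toFun a := ψ (Quotient.out a)
  map_zero_eq_one' := (hψ r).2 le_rfl _ (Ideal.Quotient.eq_zero_iff_mem.1 (Ideal.Quotient.mk_out _))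
  map_add_eq_mul' a c := by
    rw [← AddChar.map_add_eq_mul, ← sub_add_cancel (Quotient.out (a + c))
      (Quotient.out a + Quotient.out c), AddChar.map_add_eq_mul, (hψ r).2 le_rfl, one_mul]
    rw [← Ideal.Quotient.mk_eq_mk_iff_sub_mem, map_add]
    erw [Ideal.Quotient.mk_out, Ideal.Quotient.mk_out, Ideal.Quotient.mk_out]

theorem quotientChar_apply {ψ : AddChar O ℂ} (hψ : HasConductor ψ r) (x : O) :
    quotientChar hψ (toOMod O r x) = ψ x := by
  change ψ (Quotient.out (toOMod O r x)) = ψ x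
  rw [← sub_add_cancel (Quotient.out (toOMod O r x)) x, AddChar.map_add_eq_mul,
    (hψ r).2 le_rfl, one_mul]
  rw [← Ideal.Quotient.mk_eq_mk_iff_sub_mem]
  exact Ideal.Quotient.mk_out _

/-- Lift `a` to a unit times `p ^ n`. Then `ψ` is trivial on `𝔭 ^ n`, so the conductor condition
gives `r ≤ n`. -/
theorem quotientChar_primitive {ψ : AddChar O ℂ} (hψ : HasConductor ψ r) {a : OMod O r}
    (ha : ∀ y, quotientChar hψ (a * y) = 1) : a = 0 := by
  obtain ⟨p, hp⟩ := IsDiscreteValuationRing.exists_irreducible O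
  obtain ⟨x, rfl⟩ := Ideal.Quotient.mk_surjective a
  by_cases hx : x = 0
  · rw [hx, map_zero]
  obtain ⟨n, u, rfl⟩ := IsDiscreteValuationRing.eq_unit_mul_pow_irreducible hx hp
  rw [toOMod_eq_zero_iff hp]
  refine Dvd.dvd.mul_left (pow_dvd_pow p ((hψ n).1 fun y hy => ?_)) _
  rw [hp.maximalIdeal_eq, Ideal.span_singleton_pow, Ideal.mem_span_singleton] at hy
  obtain ⟨z, rfl⟩ := hy
  have h := ha (toOMod O r (↑u⁻¹ * z))
  rw [← map_mul, quotientChar_apply] at h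
  rw [← h]
  congr 1
  linear_combination (-(p ^ n * z)) * u.mul_inv

include hp in
theorem dvd_of_toResidue_eq_zero (hr : r ≠ 0) {a : OMod O r} (h : toResidue hr a = 0) :
    toOMod O r p ∣ a := by
  obtain ⟨x, rfl⟩ := Ideal.Quotient.mk_surjective a
  have h1 : x ∈ maximalIdeal O := Ideal.Quotient.eq_zero_iff_mem.1 h
  rw [hp.maximalIdeal_eq, Ideal.mem_span_singleton] at h1
  exact map_dvd _ h1

theorem isUnit_of_toResidue_ne_zero (hr : r ≠ 0) {a : OMod O r} (h : toResidue hr a ≠ 0) :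
    IsUnit a := by
  obtain ⟨x, rfl⟩ := Ideal.Quotient.mk_surjective a
  have h1 : x ∉ maximalIdeal O := fun hx => h (Ideal.Quotient.eq_zero_iff_mem.2 hx)
  rw [mem_maximalIdeal, mem_nonunits_iff, not_not] at h1
  exact h1.map _

theorem psiBeta_apply {l l' : ℕ} (hr : l + l' = r) (hl : l' ≤ l) {ψ : AddChar O ℂ}
    (hψ : HasConductor ψ r) {β : Matrix (Fin 2) (Fin 2) (OMod O l')}
    {b : Matrix (Fin 2) (Fin 2) (OMod O r)} (hb : b.map (red (by omega)) = β) (x : K O r l) :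
    psiBeta hr hl hψ β x = quotientChar hψ (b * (x.val.val - 1)).trace := by
  let B : Matrix (Fin 2) (Fin 2) O := b.map Quotient.out
  let X : Matrix (Fin 2) (Fin 2) O := x.val.val.map Quotient.out
  have hB : B.map (toOMod O r) = b := Matrix.ext fun _ _ => Ideal.Quotient.mk_out _
  have hX : X.map (toOMod O r) = x.val.val := Matrix.ext fun _ _ => Ideal.Quotient.mk_out _
  have hB' : B.map (toOMod O l') = β := by
    rw [← hb, ← hB]
    rfl
  change psiVal ψ β x.val.val = _
  rw [psiVal_eq hr hψ β x.2 hB' hX, ← quotientChar_apply hψ]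
  congr 1
  rw [← hB, ← hX, AddMonoidHom.map_trace (toOMod O r)]
  congr 1
  change (toOMod O r).mapMatrix _ = _
  rw [map_mul, map_sub, map_one]
  rfl

end DVR

/-! ### Consequences of an irreducible characteristic polynomial -/

section Cuspidal

variable {k : Type*} [Field k] {b : Matrix (Fin 2) (Fin 2) k}

/-- For `t ≠ 0` the determinant is `t ^ 2` times the characteristic polynomial at `-s / t`, and an
irreducible quadratic has no root. -/
theorem isUnit_of_irreducible_charpoly (hb : Irreducible b.charpoly) (s t : k)
    (h : s • 1 + t • b ≠ 0) : IsUnit (s • 1 + t • b) := by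
  rw [Matrix.isUnit_iff_isUnit_det, isUnit_iff_ne_zero]
  by_cases ht : t = 0
  · subst ht
    have hs : s ≠ 0 := by
      rintro rfl
      simp at h
    simpa using hs
  · intro h0
    refine hb.not_isRoot_of_natDegree_ne_one (x := -(s / t)) ?_ ?_
    · rw [Matrix.charpoly_natDegree_eq_dim]
      simp
    · have e : s • 1 + t • b = (-t) • (Matrix.scalar (Fin 2) (-(s / t)) - b) := by
        ext i j
        fin_cases i <;> fin_cases j <;> simp <;> field_simp <;> ring
      rw [e, Matrix.det_smul, ← Matrix.eval_charpoly] at h0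
      exact (mul_eq_zero.1 h0).resolve_left (pow_ne_zero _ (neg_ne_zero.2 ht))

/-- Otherwise `b` is upper triangular and `b 0 0` is a root. -/
theorem apply_one_zero_ne_zero (hb : Irreducible b.charpoly) : b 1 0 ≠ 0 := by
  intro h
  refine hb.not_isRoot_of_natDegree_ne_one (x := b 0 0) ?_ ?_
  · rw [Matrix.charpoly_natDegree_eq_dim]
    simp
  · rw [Polynomial.IsRoot, Matrix.eval_charpoly, Matrix.det_fin_two]
    simp [h]

end Cuspidal

end CuspidalGL2

end

/-! ### The main theorem -/

theorem mainTheorem1 {F : Type u} [Field F] [ValuativeRel F] [TopologicalSpace F]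
    [IsNonarchimedeanLocalField F]
    (r l l' : ℕ) (hl : 2 ≤ l) (hr : r = 2 * l - 1) (hl' : l' = l - 1)
    -- an additive character of the ring of integers with conductor `𝔭 ^ r`
    (ψ : AddChar 𝒪[F] ℂ) (hψ : HasConductor ψ r)
    -- an element of a cuspidal orbit and a lift of it
    (β : Matrix (Fin 2) (Fin 2) (OMod 𝒪[F] l')) (hβ : IsCuspidal (by omega) β)
    (b : Matrix (Fin 2) (Fin 2) (OMod 𝒪[F] r)) (hb : b.map (red (by omega)) = β)
    -- the character `ψ_β` of `K_l` and its stabilizer in `G_r`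
    (φ : K 𝒪[F] r l →* ℂ) (hφ : φ = psiBeta (l' := l') (by omega) (by omega) hψ β)
    (T : Subgroup (Gr 𝒪[F] r)) (hT : T = stabilizer (oneDim φ)) :
    -- `ψ_β` extends to `Z¹ K_l`
    (∃ χ : Z1K b l →* ℂ, ExtendsChar φ χ) ∧
    -- `Z¹ K_l` is normal in `T`, with elementary abelian quotient `Z¹ K_{l'} / Z¹ K_l`
    ((Z1K b l).subgroupOf T).Normal ∧
    IsElementaryAbelianQuotient (ringChar (IsLocalRing.ResidueField 𝒪[F])) (Z1K b l) (Z1K b l') ∧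
    -- every extension of `ψ_β` to `Z¹ K_l` is stabilized by `T`, has a non-degenerate
    -- commutator form, and is contained in a unique irreducible representation of `Z¹ K_{l'}`
    (∀ χ : Z1K b l →* ℂ, ExtendsChar φ χ →
      T ≤ stabilizer (oneDim χ) ∧
      HasNondegenerateCommutatorForm (Z1K b l) (Z1K b l') χ ∧
      (∃ (V : Type w) (_ : AddCommGroup V) (_ : Module ℂ V)
        (η : Representation ℂ (Z1K b l') V), IsEta (by omega) χ η) ∧
      (∀ (V₁ V₂ : Type w) [AddCommGroup V₁] [Module ℂ V₁] [AddCommGroup V₂] [Module ℂ V₂]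
        (η₁ : Representation ℂ (Z1K b l') V₁) (η₂ : Representation ℂ (Z1K b l') V₂),
        IsEta (by omega) χ η₁ → IsEta (by omega) χ η₂ →
          Nonempty (Representation.Equiv η₁ η₂))) ∧
    -- `T / Z¹ K_{l'}` is cyclic
    ∃ hZT : Z1K b l' ≤ T,
      (∃ _ : ((Z1K b l').subgroupOf T).Normal, IsCyclic (T ⧸ (Z1K b l').subgroupOf T)) ∧
      -- `η_β` is stabilized by `T` and extends to `T`
      (∀ χ : Z1K b l →* ℂ, ExtendsChar φ χ →
        ∀ (V : Type w) [AddCommGroup V] [Module ℂ V] (η : Representation ℂ (Z1K b l') V),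
          IsEta (by omega) χ η →
            T ≤ stabilizer η ∧
            ∃ θ : Representation ℂ T V, θ.comp (Subgroup.inclusion hZT) = η) ∧
      -- every irreducible component of `Ind ψ_β` from `K_l` to `T` is an extension of some `η_β`
      (∀ (V : Type w) [AddCommGroup V] [Module ℂ V] (θ : Representation ℂ T V),
        θ.IsIrreducible →
        Contains (Representation.ind (Subgroup.inclusion
            ((K_anti (show l' ≤ l by omega)).trans ((K_le_Z1K b l').trans hZT))) (oneDim φ)) θ →
          IsEtaTilde (by omega) φ hZT θ) ∧
      -- the representations induced from these extensions to `G_r` are irreducible and contain `ψ_β`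
      (∀ (V : Type w) [AddCommGroup V] [Module ℂ V] (θ : Representation ℂ T V),
        IsEtaTilde (by omega) φ hZT θ →
          (Representation.ind T.subtype θ).IsIrreducible ∧
          Contains ((Representation.ind T.subtype θ).comp (K 𝒪[F] r l).subtype) (oneDim φ)) ∧
      -- every irreducible representation of `G_r` containing `ψ_β` is obtained in this way
      (∀ (W : Type w) [AddCommGroup W] [Module ℂ W] (π : Representation ℂ (Gr 𝒪[F] r) W),
        π.IsIrreducible → Contains (π.comp (K 𝒪[F] r l).subtype) (oneDim φ) →
          ∃ (V : Type w) (_ : AddCommGroup V) (_ : Module ℂ V) (θ : Representation ℂ T V),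
            IsEtaTilde (by omega) φ hZT θ ∧
            Nonempty (Representation.Equiv π (Representation.ind T.subtype θ))) ∧
      -- distinct inducing representations give distinct induced representations
      (∀ (V₁ V₂ : Type w) [AddCommGroup V₁] [Module ℂ V₁] [AddCommGroup V₂] [Module ℂ V₂]
        (θ₁ : Representation ℂ T V₁) (θ₂ : Representation ℂ T V₂),
        IsEtaTilde (by omega) φ hZT θ₁ → IsEtaTilde (by omega) φ hZT θ₂ →
        Nonempty (Representation.Equiv (Representation.ind T.subtype θ₁)
          (Representation.ind T.subtype θ₂)) →
          Nonempty (Representation.Equiv θ₁ θ₂)) := by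
  have hr0 : r ≠ 0 := by omega
  have hl'1 : 1 ≤ l' := by omega
  have hll : l = l' + 1 := by omega
  have hrl : r = l + l' := by omega
  have : Finite (OMod 𝒪[F] r) := finite_OMod r
  have : Finite (Gr 𝒪[F] r) := inferInstance
  obtain ⟨p, hp⟩ := IsDiscreteValuationRing.exists_irreducible 𝒪[F]
  have hϖ := isUniformizer_of_irreducible (r := r) hp
  have hann : ∀ i ≤ r, ∀ a : OMod 𝒪[F] r, toOMod 𝒪[F] r p ^ i * a = 0 →
      toOMod 𝒪[F] r p ^ (r - i) ∣ a := fun i hi a h => pow_dvd_of_pow_mul_eq_zero hp hi h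
  have hψ' : ∀ a : OMod 𝒪[F] r, (∀ y, quotientChar hψ (a * y) = 1) → a = 0 :=
    fun a ha => quotientChar_primitive hψ ha
  have hφ' : ∀ x : K 𝒪[F] r l, φ x = quotientChar hψ (b * (x.val.val - 1)).trace := fun x => by
    rw [hφ, psiBeta_apply _ _ hψ hb]
  have hirr : Irreducible (b.map (toResidue hr0)).charpoly := by
    have h : b.map (toResidue hr0) = β.map (toResidue (by omega)) := by
      rw [← hb]
      ext i j
      obtain ⟨x, hx⟩ := Ideal.Quotient.mk_surjective (b i j)
      simp only [Matrix.map_apply, ← hx]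
      rfl
    rw [h, Matrix.charpoly_map]
    exact hβ
  have hb10 : IsUnit (b 1 0) := isUnit_of_toResidue_ne_zero hr0 (apply_one_zero_ne_zero hirr)
  have hpdvd : toOMod 𝒪[F] r p ∣ (ringChar (ResidueField 𝒪[F]) : OMod 𝒪[F] r) :=
    dvd_of_toResidue_eq_zero hp hr0 (by rw [map_natCast, ringChar.Nat.cast_ringChar])
  have helem := isElementaryAbelianQuotient_Z1K hϖ hl'1 hll hrl hann hb10 hψ' hφ' hpdvd
  have hNH : Z1K b l ≤ Z1K b l' := Z1K_anti b (by omega)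
  have hHT : Z1K b l' ≤ T := hT ▸ Z1K_le_stabilizer hϖ hl'1 hll hrl hann hψ' hφ' le_rfl
  have hKT : K 𝒪[F] r l ≤ T := (K_le_Z1K b l).trans (hNH.trans hHT)
  have hcH : ∀ t ∈ T, ∀ x ∈ Z1K b l', t * x * t⁻¹ ∈ Z1K b l' := fun t ht x hx =>
    conj_mem_Z1K hϖ hl'1 hll hrl hann hb10 hψ' hφ' (by omega) (hT ▸ ht) hx
  have hst : ∀ χ : Z1K b l →* ℂ, ExtendsChar φ χ → T ≤ stabilizer (oneDim χ) := fun χ hχ =>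
    hT ▸ stabilizer_le_stabilizer hϖ hl'1 hll hrl hann hb10 hψ' hφ' hχ
  have hnd : ∀ χ : Z1K b l →* ℂ, ExtendsChar φ χ → ∀ x ∈ Z1K b l', x ∉ Z1K b l →
      ∃ y ∈ Z1K b l', ∃ h : ⁅y, x⁆ ∈ Z1K b l, χ ⟨⁅y, x⁆, h⟩ ≠ 1 := by
    intro χ hχ x hx hxN
    by_contra! hcon
    refine hxN (mem_Z1K_of_forall_commutator hϖ hl'1 hll hrl hann hb10 hψ' hφ' hχ hx
      fun y hy h => ?_)
    have hyx := helem.2.1 y hy x hx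
    have e : (⟨⁅x, y⁆, h⟩ : Z1K b l) = ⟨⁅y, x⁆, hyx⟩⁻¹ :=
      Subtype.ext (commutatorElement_inv y x).symm
    have h1 := map_mul χ ⟨⁅y, x⁆, hyx⟩ ⟨⁅y, x⁆, hyx⟩⁻¹
    rw [mul_inv_cancel, map_one, hcon y hy hyx, one_mul] at h1
    rw [e, ← h1]
  obtain ⟨c, hcT, hc⟩ := exists_generator hϖ hl'1 hll hrl hann hb10 hψ' hφ' (toResidue hr0)
    (fun a ha => dvd_of_toResidue_eq_zero hp hr0 ha) (isUnit_of_irreducible_charpoly hirr)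
  rw [← hT] at hcT hc
  have hKeta : ∀ χ : Z1K b l →* ℂ, ExtendsChar φ χ → ∀ {V : Type w} [AddCommGroup V] [Module ℂ V]
      {η : Representation ℂ (Z1K b l') V}, IsEta (by omega) χ η → IsScalarOn hNH χ η :=
    fun χ hχ V _ _ η hη => isScalarOn_of_contains (hst χ hχ) hHT hNH hη.1 hη.2
  -- This intrinsic description of the `η̃_β` reduces the last assertions to Clifford theory over
  -- `K_l`.
  have htilde : ∀ {V : Type w} [AddCommGroup V] [Module ℂ V] {θ : Representation ℂ T V},
      IsEtaTilde (by omega) φ hHT θ ↔ θ.IsIrreducible ∧ IsScalarOn hKT φ θ := by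
    intro V _ _ θ
    constructor
    · rintro ⟨χ, hχ, η, hη, rfl⟩
      exact ⟨isIrreducible_of_comp _ hη.1,
        (isScalarOn_comp_iff.1 (hKeta χ hχ hη)).of_comp (K_le_Z1K b l) hχ⟩
    · rintro ⟨hθ, hs⟩
      have := nontrivial_of_isIrreducible hθ
      -- The extension `χ` is not given but read off from an eigenvector of `Z¹ K_l` in `θ`.
      obtain ⟨χ, hχ, v, hv, hv'⟩ := exists_eigenvector (Z := Z1 b) (K := K 𝒪[F] r l)
        (fun x hx y hy => mul_comm_of_mem_unitsAdjoin hx.1 hy.1) (K_le_Z1K b l)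
        rfl (hNH.trans hHT) hs
      have hs' : IsScalarOn (hNH.trans hHT) χ θ :=
        isScalarOn_of_eigenvector (hst χ hχ) le_rfl _ hθ hv hv'
      have hirr' := isIrreducible_comp_inclusion hNH hHT hcH (hst χ hχ) (hnd χ hχ) hcT hc hθ hs'
      exact ⟨χ, hχ, θ.comp (Subgroup.inclusion hHT), ⟨hirr',
        IsScalarOn.contains (hNX := hNH) (isScalarOn_comp_iff.2 hs')⟩, rfl⟩
  have hnormH : ((Z1K b l').subgroupOf T).Normal := ⟨fun x hx g => hcH g g.2 x hx⟩
  refine ⟨exists_extendsChar hϖ hl'1 hll hrl hann hψ' hφ',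
    normal_subgroupOf_stabilizer hϖ hl'1 hll hrl hann hb10 hψ' hφ' le_rfl hT.le, helem,
    fun χ hχ => ⟨hst χ hχ, hasNondegenerateCommutatorForm_Z1K hϖ hl'1 hll hrl hann hb10 hψ' hφ' hχ
      helem.2.1, ?_, ?_⟩, hHT, ⟨hnormH, isCyclic_quotient hcT hc⟩, ?_, ?_, ?_, ?_, ?_⟩
  · obtain ⟨V, _, _, η, hη, hs⟩ := exists_isIrreducible_scalar.{_, _, w} (G := Z1K b l')
      (i := Subgroup.inclusion hNH) (Subgroup.inclusion_injective hNH) χ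
      (exists_conj_eq (hst χ hχ) hHT hNH)
    have := nontrivial_of_isIrreducible hη
    exact ⟨V, _, _, η, hη, IsScalarOn.contains (hNX := hNH) hs⟩
  · intro V₁ V₂ _ _ _ _ η₁ η₂ h₁ h₂
    exact equiv_of_isScalarOn hNH (hnd χ hχ) h₁.1 h₂.1 (hKeta χ hχ h₁) (hKeta χ hχ h₂)
  · intro χ hχ V _ _ η hη
    have h := le_stabilizer_of_isScalarOn hNH hHT hcH (hst χ hχ) (hnd χ hχ) hη.1 (hKeta χ hχ hη)
    exact ⟨h, exists_extension_of_le_stabilizer hHT hcH hcT hc hη.1 h⟩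
  · intro V _ _ θ hθ hcon
    exact htilde.2 ⟨hθ, isScalarOn_of_contains_ind hT hKT hcon⟩
  · intro V _ _ θ hθ
    obtain ⟨h1, h2⟩ := htilde.1 hθ
    exact ⟨ind_isIrreducible hT hKT h1 h2, ind_contains hKT h1 h2⟩
  · intro W _ _ π hπ hcon
    obtain ⟨V, _, _, θ, h1, h2, h3⟩ := exists_equiv_ind hT hKT hπ hcon
    exact ⟨V, _, _, θ, htilde.2 ⟨h1, h2⟩, h3⟩
  · rintro V₁ V₂ _ _ _ _ θ₁ θ₂ h₁ h₂ ⟨e⟩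
    obtain ⟨h1, h1'⟩ := htilde.1 h₁
    obtain ⟨h2, h2'⟩ := htilde.1 h₂
    exact equiv_of_ind_equiv hT hKT h1 h2 h1' h2' e
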